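/- Let $q=p^r$ be a prime power, let $\mathbb F_q=\mathbb Z_p[\theta]$ have the $\mathbb Z_p$-basis $1,\theta,\dots,\theta^{r-1}$, let $\psi:\mathbb F_q\to\mathbb Z_p^r$ be the coordinate map, let $\varphi:\{0,\dots,q-1\}\to\mathbb F_q$ be a bijection with $\varphi(0)=0$, and put $\eta=\psi\circ\varphi$, with components $\eta_1,\dots,\eta_r$. For $k=\kappa_0+\kappa_1q+\dots+\kappa_{m-1}q^{m-1}\in\mathbb N_0$ and $x=x_1q^{-1}+x_2q^{-2}+\cdots\in[0,1)$ (infinitely many $x_l\ne q-1$) let $$\mathrm{wal}_k(x)=\exp\Big(\frac{2\pi\mathrm i}{p}\sum_{l=0}^{m-1}\sum_{i=1}^r\eta_i(\kappa_l)\,\eta_i(x_{l+1})\Big),$$ and for $\boldsymbol k\in\mathbb N_0^s$ let $\mathrm{wal}_{\boldsymbol k}(\boldsymbol x)=\prod_{j=1}^s\mathrm{wal}_{k_j}(x_j)$ and $\hat f(\boldsymbol k)=\int_{[0,1)^s}f(\boldsymbol x)\overline{\mathrm{wal}_{\boldsymbol k}(\boldsymbol x)}\,\mathrm d\boldsymbol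 x$. **Variation.** Let $0<\lambda\le1$ and $\mathfrak p,\mathfrak q,\mathfrak r\ge1$ be real. For $g:[0,1)^d\to\mathbb R$ and a box $J=\prod_j[x_j,y_j)$ let $\Delta(g,J)$ be the alternating sum of $g$ over the vertices of $J$ (adjacent vertices having opposite signs), and $$V^{(d)}_{\lambda,\mathfrak p}(g)=\sup_{\mathcal P}\Big(\sum_{J}\mathrm{Vol}(J)\Big|\frac{\Delta(g,J)}{\mathrm{Vol}(J)^{\lambda}}\Big|^{\mathfrak p}\Big)^{1/\mathfrak p},$$ the supremum being over all finite partitions $\mathcal P$ of $[0,1)^d$ into half-open boxes and the sum over those $J\in\mathcal P$ all of whose vertices lie in $[0,1)^d$, the domain of $g$; $V^{(0)}_{\lambda,\mathfrak p}(g)=|g|$ for a constant $g$. For $g$ integrable on $[0,1)^d$ and $w\subseteq\{1,\dots,d\}$ let $g_w$ be the function of $(x_j)_{j\in w}$ obtained by integrating $g$ over $[0,1)$ in every variable $x_j$, $j\notin w$, and put $V_{\lambda,\mathfrak p,\mathfrak q}(g)=\big(\sum_{w}V^{(|w|)}_{\lambda,\mathfrak p}(g_w)^{\mathfrak q}\big)^{1/\mathfrak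 q}$; for $g$ not integrable put $V_{\lambda,\mathfrak p,\mathfrak q}(g)=\infty$. **The functional $N$.** Let $\delta\ge1$ be an integer and $\gamma=(\gamma_v)_{v\subseteq\{1,\dots,s\}}$ non-negative reals. Let $f:[0,1)^s\to\mathbb R$ be such that the mixed partial derivatives $f^{(\boldsymbol\tau)}=\partial_1^{\tau_1}\cdots\partial_s^{\tau_s}f$, $\boldsymbol\tau\in\{0,\dots,\delta\}^s$, exist on $[0,1)^s$ (one-sided where $x_j=0$). With $u(\boldsymbol\tau)=\{j:\tau_j=\delta\}$ and $v(\boldsymbol\tau)=\{j:\tau_j>0\}$ let $$N_{\delta,\lambda,\gamma}(f)=\Big(\sum_{\boldsymbol\tau\in\{0,\dots,\delta\}^s}\gamma_{v(\boldsymbol\tau)}^{-1}\,V_{\lambda,\mathfrak p,\mathfrak q}\big(f^{(\boldsymbol\tau)}(\cdot,\boldsymbol 0)\big)^{\mathfrak r}\Big)^{1/\mathfrak r}\in[0,\infty],$$ where $f^{(\boldsymbol\tau)}(\cdot,\boldsymbol0)$ is the function of the variables $x_j$, $j\in u(\boldsymbol\tau)$, obtained by setting all other variables to $0$, and where for $\gamma_v=0$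 one reads $0/0=0$ and $c/0=\infty$ for $c>0$. **The weight $\mu$.** For $k=\kappa_1q^{a_1-1}+\dots+\kappa_vq^{a_v-1}$ with $\kappa_i\in\{1,\dots,q-1\}$ and $a_1>\dots>a_v\ge1$ put $\mu_{q,\delta+\lambda}(k)=a_1+\dots+a_v$ if $v\le\delta$ (so $\mu_{q,\delta+\lambda}(0)=0$) and $\mu_{q,\delta+\lambda}(k)=a_1+\dots+a_\delta+\lambda a_{\delta+1}$ if $v>\delta$; put $\mu_{q,\delta+\lambda}(\boldsymbol k)=\sum_{j=1}^s\mu_{q,\delta+\lambda}(k_j)$. **Theorem.** For given $q$, $s$, $\delta\ge1$ and $\gamma$ there is a constant $C_{\delta,q,s,\gamma}>0$ such that for all $\mathbb F_q,\theta,\varphi$ as above, all $0<\lambda\le1$, $\mathfrak p,\mathfrak q,\mathfrak r\ge1$, and every $f:[0,1)^s\to\mathbb R$ whose mixed partial derivatives $f^{(\boldsymbol\tau)}$, $\boldsymbol\tau\in\{0,\dots,\delta\}^s$, exist and which satisfies $N_{\delta,\lambda,\gamma}(f)<\infty$, one has $f\in L_2([0,1)^s)$ and: 1. there is a constant $C_f>0$,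 independent of $\boldsymbol k$, with $|\hat f(\boldsymbol k)|\le C_f\,q^{-\mu_{q,\delta+\lambda}(\boldsymbol k)}$ for all $\boldsymbol k\in\mathbb N_0^s\setminus\{\boldsymbol0\}$; 2. $|\hat f(\boldsymbol k)|\le C_{\delta,q,s,\gamma}\,N_{\delta,\lambda,\gamma}(f)\,q^{-\mu_{q,\delta+\lambda}(\boldsymbol k)}$ for all $\boldsymbol k\in\mathbb N_0^s$. -/

import Mathlib

open MeasureTheory
open scoped ENNReal NNReal

noncomputable section

namespace WalshDecay

/-! ### Boxes and the generalized variation in the sense of Vitali -/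

/-- The half-open box `∏ⱼ [aⱼ, bⱼ)`. -/
def box {ι : Type*} (a b : ι → ℝ) : Set (ι → ℝ) :=
  Set.univ.pi fun j => Set.Ico (a j) (b j)

/-- The half-open unit cube `[0,1)^ι`. -/
def unitCube (ι : Type*) : Set (ι → ℝ) :=
  box (fun _ => 0) (fun _ => 1)

/-- The volume `∏ⱼ (bⱼ - aⱼ)` of the box `J = ∏ⱼ [aⱼ, bⱼ)`, given as `J = (a, b)`. -/
def boxVol {ι : Type*} [Fintype ι] (J : (ι → ℝ) × (ι → ℝ)) : ℝ :=
  ∏ j, (J.2 j - J.1 j)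

/-- `Δ(g, J)`: the alternating sum of `g` over the vertices of the box `J = (a, b)`; the set `w`
lists the coordinates in which the upper endpoint is taken. -/
def boxDelta {ι : Type*} [Fintype ι] [DecidableEq ι] (g : (ι → ℝ) → ℝ)
    (J : (ι → ℝ) × (ι → ℝ)) : ℝ :=
  ∑ w : Finset ι, (-1) ^ w.card * g fun j => if j ∈ w then J.2 j else J.1 j

/-- `P` is a partition of the unit cube into finitely many nondegenerate half-open boxes. -/
structure IsPartition {ι : Type*} (P : Finset ((ι → ℝ) × (ι → ℝ))) : Prop where
  nondegenerate : ∀ J ∈ P, ∀ j, J.1 j < J.2 j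
  disjoint : ∀ J ∈ P, ∀ J' ∈ P, J ≠ J' → Disjoint (box J.1 J.2) (box J'.1 J'.2)
  cover : ⋃ J ∈ P, box J.1 J.2 = unitCube ι

open Classical in
/-- The generalized variation in the sense of Vitali
`sup_P (∑_{J ∈ P} Vol(J) |Δ(g,J) / Vol(J)^lam|^p)^(1/p)`, with values in `[0,∞]`.
As `g` is a function on `[0,1)^ι`, the difference `Δ(g,J)` makes sense only when all vertices of
`J` lie in `[0,1)^ι`, and the sum runs over those `J ∈ P`. (If `g` extends continuously to the
closed cube, the supremum is the same as with the boxes that touch the upper faces included.)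
If `ι` is empty, the value is the absolute value of the constant `g`. -/
def vitaliVar {ι : Type*} [Fintype ι] (lam p : ℝ) (g : (ι → ℝ) → ℝ) : ℝ≥0∞ :=
  ⨆ (P : Finset ((ι → ℝ) × (ι → ℝ))) (_ : IsPartition P),
    (∑ J ∈ P with ∀ j, J.2 j < 1,
      ENNReal.ofReal (boxVol J * |boxDelta g J / boxVol J ^ lam| ^ p)) ^ (1 / p)

/-! ### The generalized Hardy and Krause variation -/

open Classical in
/-- The projection `g_w(x_w) = ∫_{[0,1)^{ι \ w}} g(x) dx_{ι \ w}`. -/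
def proj {ι : Type*} [Fintype ι] (g : (ι → ℝ) → ℝ) (w : Finset ι) :
    ({j // j ∈ w} → ℝ) → ℝ := fun x =>
  ∫ y in unitCube {j // j ∉ w}, g fun j => if h : j ∈ w then x ⟨j, h⟩ else y ⟨j, h⟩

open Classical in
/-- The generalized Hardy and Krause variation
`(∑_{w ⊆ ι} (V_{lam,p}(g_w))^q)^(1/q)`, including the term `w = ∅`.
The projections `g_w` presuppose that `g` is integrable; otherwise the value is `∞`. -/
def hardyKrauseVar {ι : Type*} [Fintype ι] (lam p q : ℝ) (g : (ι → ℝ) → ℝ) : ℝ≥0∞ :=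
  if IntegrableOn g (unitCube ι) then
    (∑ w : Finset ι, vitaliVar lam p (proj g w) ^ q) ^ (1 / q)
  else ∞

/-! ### Mixed partial derivatives on `[0,1)^s` -/

/-- The partial derivative in the `j`-th coordinate of a function on `[0,1)^s`
(one-sided where `x j = 0`). -/
def partialDeriv {s : ℕ} (j : Fin s) (g : (Fin s → ℝ) → ℝ) : (Fin s → ℝ) → ℝ := fun x =>
  derivWithin (fun t => g (Function.update x j t)) (Set.Ico 0 1) (x j)

/-- The mixed partial derivative `f^(τ) = ∂₁^τ₁ (∂₂^τ₂ (⋯ (∂ₛ^τₛ f)))`. -/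
def mixedDeriv {s : ℕ} (f : (Fin s → ℝ) → ℝ) (τ : Fin s → ℕ) : (Fin s → ℝ) → ℝ :=
  (List.finRange s).foldr (fun j g => (partialDeriv j)^[τ j] g) f

/-- The mixed partial derivatives `f^(τ)`, `τ ∈ {0,…,δ}^s`, exist on `[0,1)^s`: each
differentiation that occurs in forming one of them, namely `∂ⱼ f^(τ)` with `τ j < δ` and
`τ i = 0` for `i < j`, is possible at every point of `[0,1)^s`. -/
def HasMixedDerivs {s : ℕ} (δ : ℕ) (f : (Fin s → ℝ) → ℝ) : Prop :=
  ∀ τ : Fin s → ℕ, (∀ i, τ i ≤ δ) → ∀ j, τ j < δ → (∀ i, i < j → τ i = 0) →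
    ∀ x ∈ unitCube (Fin s),
      DifferentiableWithinAt ℝ (fun t => mixedDeriv f τ (Function.update x j t))
        (Set.Ico 0 1) (x j)

/-! ### The functional `N` -/

/-- `u(τ) = {j : τⱼ = δ}`. -/
def topSet {s : ℕ} (δ : ℕ) (τ : Fin s → ℕ) : Finset (Fin s) :=
  Finset.univ.filter fun j => τ j = δ

/-- `v(τ) = {j : τⱼ > 0}`. -/
def posSet {s : ℕ} (τ : Fin s → ℕ) : Finset (Fin s) :=
  Finset.univ.filter fun j => 0 < τ j

/-- The function `f^(τ)(·, 0)` of the variables `x_j`, `j ∈ u(τ)`, all other variables being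
set to `0`. -/
def anchored {s : ℕ} (δ : ℕ) (f : (Fin s → ℝ) → ℝ) (τ : Fin s → ℕ) :
    ({j // j ∈ topSet δ τ} → ℝ) → ℝ := fun y =>
  mixedDeriv f τ fun j => if h : j ∈ topSet δ τ then y ⟨j, h⟩ else 0

/-- `N_{δ,lam,γ}(f)`, with values in `[0,∞]`. The arithmetic of `[0,∞]` has `0⁻¹ = ∞` and
`∞ * 0 = 0`: for `γ_v = 0` this is the convention `0 / 0 = 0`, and finiteness forces the variation
to vanish for all `τ` with `v(τ) = v`. -/
def N {s : ℕ} (δ : ℕ) (lam p q r : ℝ) (γ : Finset (Fin s) → ℝ≥0) (f : (Fin s → ℝ) → ℝ) : ℝ≥0∞ :=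
  (∑ τ ∈ Fintype.piFinset fun _ : Fin s => Finset.range (δ + 1),
    (γ (posSet τ) : ℝ≥0∞)⁻¹ * hardyKrauseVar lam p q (anchored δ f τ) ^ r) ^ (1 / r)

/-! ### Walsh functions over the additive group of a finite field -/

/-- The `l`-th digit `κ_l` of `k = κ₀ + κ₁ q + κ₂ q² + ⋯`. -/
def natDigit (q : ℕ) [NeZero q] (k l : ℕ) : Fin q :=
  Fin.ofNat q (k / q ^ l)

/-- The `k`-th Walsh function on `[0,1)` over the field `F` with `q` elements. The field is
`F = (ZMod p)[θ]` with basis `1, θ, …, θ^(r-1)`, packaged as the power basis `pb`, whose coordinate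
map is `ψ : F → (ZMod p)^r`; `φ` is a bijection from the digits onto `F`, and
`Real.digits x q l` is the digit `x_{l+1}` of `x = x₁/q + x₂/q² + ⋯`. -/
def wal {p : ℕ} [NeZero p] {F : Type*} [Field F] [Algebra (ZMod p) F]
    (pb : PowerBasis (ZMod p) F) {q : ℕ} [NeZero q] (φ : Fin q → F) (k : ℕ) (x : ℝ) : ℂ :=
  Complex.exp (2 * Real.pi * Complex.I / p *
    ∑ l ∈ Finset.range (Nat.digits q k).length, ∑ i : Fin pb.dim,
      (((pb.basis.repr (φ (natDigit q k l)) i).val : ℂ) *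
        ((pb.basis.repr (φ (Real.digits x q l)) i).val : ℂ)))

/-- The Walsh coefficient `∫_{[0,1)^s} f(x) conj(wal_k(x)) dx`, `wal_k(x) = ∏ⱼ wal_{kⱼ}(xⱼ)`. -/
def walshCoeff {p : ℕ} [NeZero p] {F : Type*} [Field F] [Algebra (ZMod p) F]
    (pb : PowerBasis (ZMod p) F) {q : ℕ} [NeZero q] (φ : Fin q → F) {s : ℕ}
    (f : (Fin s → ℝ) → ℝ) (k : Fin s → ℕ) : ℂ :=
  ∫ x in unitCube (Fin s), (f x : ℂ) * (starRingEnd ℂ) (∏ j, wal pb φ (k j) (x j))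

/-! ### The weight `μ` -/

/-- The positions `a₁ > a₂ > ⋯ > a_v ≥ 1` of the nonzero digits of
`k = κ₁ q^(a₁-1) + ⋯ + κ_v q^(a_v-1)`, in decreasing order. -/
def digitPositions (q : ℕ) (k : ℕ) : List ℕ :=
  (((Finset.range (Nat.digits q k).length).filter fun l => k / q ^ l % q ≠ 0).image
    (· + 1)).sort (· ≥ ·)

/-- `μ_{q,δ+lam}(k)`: the sum `a₁ + ⋯ + a_v` if `v ≤ δ`, and `a₁ + ⋯ + a_δ + lam a_{δ+1}`
if `v > δ`. -/
def mu₁ (q δ : ℕ) (lam : ℝ) (k : ℕ) : ℝ :=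
  (((digitPositions q k).take δ).sum : ℝ) + lam * ((digitPositions q k).getD δ 0 : ℝ)

/-- `μ_{q,δ+lam}(k₁,…,kₛ) = ∑ⱼ μ_{q,δ+lam}(kⱼ)`. -/
def mu (q δ : ℕ) (lam : ℝ) {s : ℕ} (k : Fin s → ℕ) : ℝ :=
  ∑ j, mu₁ q δ lam (k j)

end WalshDecay

end

/-!
The theorem rests on three facts: a Taylor formula in which `f` is recovered from the functions
`f^(τ)(·, 0)`, the effect of repeated integration on Walsh functions, and a bound for the integral
of a function of bounded variation against oscillating factors.

*Taylor's formula* (`eq_sum_integral_mixedDeriv`). For `x` in the cube, `f x` is the sum over `τ` of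
the integrals of `f^(τ)(t)` times a product of one-dimensional Taylor kernels, with respect to the
product measure that is Lebesgue measure on `[0,1)` in the coordinates with `τ j = δ` and the point
mass at `0` in the others. Nothing is assumed about the derivatives away from the faces except that
they exist: the formula in the remaining variables, valid for almost every value of the last one,
shows that the top derivative in the last variable is integrable along every line. In particular
`f` is bounded and measurable, hence in `L₂`.

*Walsh functions* (`isModulated_tailInt_iterate`). Integrating Taylor's formula against a Walsh
function leaves the `(i+1)`-fold primitives of one-dimensional Walsh functions at `0`, for `i < δ`,
and their `δ`-fold primitives, for the remainder. Let `a₁ > a₂ > ⋯` be the positions of the nonzero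
digits of `k`. The finest factor has mean zero on each cell of length `q^(1-a₁)`, on which the other
factors are constant; so the primitive of the Walsh function is the product of the remaining factors
with a function of period `q^(1-a₁)` bounded by `q^(1-a₁)`. Iterating, the `δ`-fold primitive is
bounded by a constant times `q^(-a₁-⋯-a_δ)` and has mean zero on the cells of length
`q^(1-a_{δ+1})`. The `(i+1)`-fold primitives vanish at `0` once `k` has more than `i` nonzero digits.

*Bounded variation* (`enorm_setIntegral_mul_prod_le`). A factor `ξ` with mean zero on cells of length
`h` is an average of its differences `ξ(z) - ξ(z + d)` within the cells, over the steps
`0 < d < h`. Moving these differences to the other factor `g` turns `∫ g ∏ ξ_j` into integrals of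
`Δ(g, ∏ [t_j, t_j + d_j))`. For fixed `d` the boxes at lattice translates of `t` belong to one
partition of the cube, so by Hölder's inequality the mean of `|Δ|` over `t` is at most `V(g) ∏ d_j^λ`
(`lintegral_increment_le`). This supplies the factor `∏ h_j^λ`, with a constant that does not depend
on `λ`. Coordinates without oscillation are treated by splitting off the mean, which leads to the
projections `g_w` in the Hardy and Krause variation (`enorm_setIntegral_mul_prod_le_hardyKrauseVar`).
-/

namespace WalshDecay

/-! ### Grid partitions of the unit cube -/

/-- The smallest element of `S ∪ {1}` exceeding `a`, for a finite set `S` of cut points (the value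
is `1` if no point of `S` exceeds `a`). -/
noncomputable def nextCut (S : Finset ℝ) (a : ℝ) : ℝ :=
  (insert 1 (S.filter (a < ·))).min' (Finset.insert_nonempty _ _)

lemma lt_nextCut {S : Finset ℝ} {a : ℝ} (ha : a < 1) : a < nextCut S a := by
  refine (Finset.lt_min'_iff _ _).2 fun y hy => ?_
  rcases Finset.mem_insert.1 hy with rfl | h
  · exact ha
  · exact (Finset.mem_filter.1 h).2

lemma nextCut_le_one (S : Finset ℝ) (a : ℝ) : nextCut S a ≤ 1 :=
  Finset.min'_le _ _ (Finset.mem_insert_self _ _)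

lemma nextCut_le {S : Finset ℝ} {a b : ℝ} (hb : b ∈ S) (hab : a < b) : nextCut S a ≤ b :=
  Finset.min'_le _ _ (Finset.mem_insert_of_mem (Finset.mem_filter.2 ⟨hb, hab⟩))

lemma nextCut_eq {S : Finset ℝ} {a b : ℝ} (hb : b ∈ S) (hab : a < b) (hb1 : b ≤ 1)
    (h : ∀ c ∈ S, a < c → b ≤ c) : nextCut S a = b := by
  refine le_antisymm (nextCut_le hb hab) ?_
  refine (Finset.le_min'_iff _ _).2 fun y hy => ?_
  rcases Finset.mem_insert.1 hy with rfl | h'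
  · exact hb1
  · exact h y (Finset.mem_filter.1 h').1 (Finset.mem_filter.1 h').2

open Classical in
/-- The product of the one-dimensional partitions of `[0,1)` with cut points `S j`. -/
noncomputable def gridPartition {ι : Type*} [Fintype ι] (S : ι → Finset ℝ) :
    Finset ((ι → ℝ) × (ι → ℝ)) :=
  (Fintype.piFinset S).image fun a => (a, fun j => nextCut (S j) (a j))

lemma mem_gridPartition {ι : Type*} [Fintype ι] {S : ι → Finset ℝ} {J : (ι → ℝ) × (ι → ℝ)} :
    J ∈ gridPartition S ↔ (∀ j, J.1 j ∈ S j) ∧ ∀ j, J.2 j = nextCut (S j) (J.1 j) := by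
  classical
  unfold gridPartition
  simp only [Finset.mem_image, Fintype.mem_piFinset]
  constructor
  · rintro ⟨a, ha, rfl⟩
    exact ⟨ha, fun _ => rfl⟩
  · rintro ⟨h1, h2⟩
    exact ⟨J.1, h1, Prod.ext rfl (funext fun j => (h2 j).symm)⟩

lemma isPartition_gridPartition {ι : Type*} [Fintype ι] {S : ι → Finset ℝ}
    (h0 : ∀ j, (0 : ℝ) ∈ S j) (hS : ∀ j, ∀ a ∈ S j, 0 ≤ a ∧ a < 1) :
    IsPartition (gridPartition S) where
  nondegenerate J hJ j := by
    rw [mem_gridPartition] at hJ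
    rw [hJ.2 j]
    exact lt_nextCut (hS j _ (hJ.1 j)).2
  disjoint J hJ J' hJ' hne := by
    rw [mem_gridPartition] at hJ hJ'
    have hne' : J.1 ≠ J'.1 := fun h => hne (Prod.ext h (funext fun j => by
      rw [hJ.2, hJ'.2, h]))
    obtain ⟨j, hj⟩ := Function.ne_iff.1 hne'
    rw [Set.disjoint_left]
    intro x hx hx'
    have h1 := hx j (Set.mem_univ j)
    have h2 := hx' j (Set.mem_univ j)
    simp only [hJ.2, Set.mem_Ico] at h1
    simp only [hJ'.2, Set.mem_Ico] at h2
    rcases lt_or_gt_of_ne hj with h | h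
    · have := nextCut_le (hJ'.1 j) h
      linarith
    · have := nextCut_le (hJ.1 j) h
      linarith
  cover := by
    ext x
    simp only [Set.mem_iUnion, exists_prop]
    constructor
    · rintro ⟨J, hJ, hx⟩ j -
      rw [mem_gridPartition] at hJ
      have h1 := hx j (Set.mem_univ j)
      simp only [hJ.2, Set.mem_Ico] at h1
      exact ⟨(hS j _ (hJ.1 j)).1.trans h1.1, h1.2.trans_le (nextCut_le_one _ _)⟩
    · intro hx
      have hx' : ∀ j, 0 ≤ x j ∧ x j < 1 := fun j => hx j (Set.mem_univ j)
      have hne : ∀ j, ((S j).filter (· ≤ x j)).Nonempty := fun j =>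
        ⟨0, Finset.mem_filter.2 ⟨h0 j, (hx' j).1⟩⟩
      set a : ι → ℝ := fun j => ((S j).filter (· ≤ x j)).max' (hne j) with ha
      have ha' : ∀ j, a j ∈ (S j).filter (· ≤ x j) := fun j => Finset.max'_mem _ _
      refine ⟨(a, fun j => nextCut (S j) (a j)),
        mem_gridPartition.2 ⟨fun j => (Finset.mem_filter.1 (ha' j)).1, fun _ => rfl⟩, ?_⟩
      intro j _
      refine ⟨(Finset.mem_filter.1 (ha' j)).2, ?_⟩
      show x j < nextCut (S j) (a j)
      refine (Finset.lt_min'_iff _ _).2 fun y hy => ?_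
      rcases Finset.mem_insert.1 hy with rfl | h'
      · exact (hx' j).2
      · by_contra hcon
        have h3 := Finset.mem_filter.1 h'
        have hy' : y ∈ (S j).filter (· ≤ x j) := Finset.mem_filter.2 ⟨h3.1, not_lt.1 hcon⟩
        have : y ≤ a j := Finset.le_max' _ _ hy'
        exact absurd h3.2 (not_lt.2 this)

/-! ### The variation bounds sums of differences over packings -/

lemma volume_box {ι : Type*} [Fintype ι] (J : (ι → ℝ) × (ι → ℝ)) (h : ∀ j, J.1 j < J.2 j) :
    volume (box J.1 J.2) = ENNReal.ofReal (boxVol J) := by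
  unfold box boxVol
  rw [Real.volume_pi_Ico, ENNReal.ofReal_prod_of_nonneg fun j _ => (sub_pos.2 (h j)).le]

lemma measurableSet_box {ι : Type*} [Fintype ι] (a b : ι → ℝ) : MeasurableSet (box a b) :=
  MeasurableSet.univ_pi fun _ => measurableSet_Ico

lemma measurableSet_unitCube (ι : Type*) [Fintype ι] : MeasurableSet (unitCube ι) :=
  measurableSet_box _ _

lemma mem_unitCube {ι : Type*} {x : ι → ℝ} : x ∈ unitCube ι ↔ ∀ j, x j ∈ Set.Ico (0 : ℝ) 1 := by
  simp [unitCube, box, Set.mem_pi]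

lemma volume_unitCube (ι : Type*) [Fintype ι] : volume (unitCube ι) = 1 := by
  unfold unitCube
  rw [volume_box (fun _ => 0, fun _ => 1) (by simp)]
  simp [boxVol]

lemma boxVol_pos {ι : Type*} [Fintype ι] {J : (ι → ℝ) × (ι → ℝ)} (h : ∀ j, J.1 j < J.2 j) :
    0 < boxVol J := Finset.prod_pos fun j _ => sub_pos.2 (h j)

lemma IsPartition.sum_boxVol {ι : Type*} [Fintype ι] {P : Finset ((ι → ℝ) × (ι → ℝ))}
    (hP : IsPartition P) : ∑ J ∈ P, ENNReal.ofReal (boxVol J) = 1 := by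
  rw [← volume_unitCube ι, ← hP.cover, measure_biUnion_finset]
  · exact Finset.sum_congr rfl fun J hJ => (volume_box J (hP.nondegenerate J hJ)).symm
  · exact fun J hJ J' hJ' hne => hP.disjoint J hJ J' hJ' hne
  · exact fun J _ => measurableSet_box _ _

open Classical in
/-- By Hölder's inequality the variation with exponent `p` bounds the variation with exponent `1`,
since the volumes of the boxes add up to at most `1`. -/
lemma IsPartition.sum_le_vitaliVar {ι : Type*} [Fintype ι] {P : Finset ((ι → ℝ) × (ι → ℝ))}
    (hP : IsPartition P) (lam : ℝ) {p : ℝ} (hp : 1 ≤ p) (g : (ι → ℝ) → ℝ)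
    {T : Finset ((ι → ℝ) × (ι → ℝ))} (hT : T ⊆ P) (hT1 : ∀ J ∈ T, ∀ j, J.2 j < 1) :
    ∑ J ∈ T, ENNReal.ofReal (boxVol J) * ENNReal.ofReal (|boxDelta g J| / boxVol J ^ lam) ≤
      vitaliVar lam p g := by
  have hp0 : 0 ≤ p := by linarith
  have hTP : T ⊆ P.filter fun J => ∀ j, J.2 j < 1 := fun J hJ =>
    Finset.mem_filter.2 ⟨hT hJ, hT1 J hJ⟩
  calc ∑ J ∈ T, ENNReal.ofReal (boxVol J) * ENNReal.ofReal (|boxDelta g J| / boxVol J ^ lam)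
      ≤ (∑ J ∈ T, ENNReal.ofReal (boxVol J)) ^ (1 - p⁻¹) *
        (∑ J ∈ T, ENNReal.ofReal (boxVol J) *
          ENNReal.ofReal (|boxDelta g J| / boxVol J ^ lam) ^ p) ^ p⁻¹ :=
        ENNReal.inner_le_weight_mul_Lp_of_nonneg _ hp _ _
    _ ≤ 1 * vitaliVar lam p g := by
        refine mul_le_mul' ?_ ?_
        · refine ENNReal.rpow_le_one ?_ (sub_nonneg.2 (inv_le_one_of_one_le₀ hp))
          rw [← hP.sum_boxVol]
          exact Finset.sum_le_sum_of_subset hT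
        · unfold vitaliVar
          refine le_trans ?_ (le_iSup₂ (f := fun (P : Finset ((ι → ℝ) × (ι → ℝ)))
            (_ : IsPartition P) => (∑ J ∈ P with ∀ j, J.2 j < 1,
              ENNReal.ofReal (boxVol J * |boxDelta g J / boxVol J ^ lam| ^ p)) ^ (1 / p)) P hP)
          rw [← one_div]
          refine ENNReal.rpow_le_rpow ?_ (by positivity)
          refine le_trans (Finset.sum_le_sum fun J hJ => le_of_eq ?_)
            (Finset.sum_le_sum_of_subset hTP)
          have hv := boxVol_pos (hP.nondegenerate J (hT hJ))
          rw [ENNReal.ofReal_mul hv.le, abs_div, abs_of_pos (Real.rpow_pos_of_pos hv lam),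
            ENNReal.ofReal_rpow_of_nonneg (by positivity) hp0]
    _ = vitaliVar lam p g := one_mul _

/-- The box `∏ⱼ [yⱼ + cⱼ dⱼ, yⱼ + (cⱼ + 1) dⱼ)`. -/
def shiftBox {ι : Type*} (y d : ι → ℝ) (c : ι → ℤ) : (ι → ℝ) × (ι → ℝ) :=
  (fun j => y j + c j * d j, fun j => y j + c j * d j + d j)

lemma exists_partition_shiftBox {ι : Type*} [Fintype ι] (y d : ι → ℝ)
    (hd : ∀ j, 0 < d j) (T : Finset (ι → ℤ))
    (hT : ∀ c ∈ T, ∀ j, 0 ≤ (shiftBox y d c).1 j ∧ (shiftBox y d c).2 j < 1) :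
    ∃ P, IsPartition P ∧ ∀ c ∈ T, shiftBox y d c ∈ P := by
  classical
  -- Cut every coordinate axis at all points `y j + m * d j` that lie in `[0,1)`.
  set N : ι → ℤ := fun j => ⌈(|y j| + 1) / d j⌉ with hN
  set S : ι → Finset ℝ := fun j =>
    insert 0 (((Finset.Icc (-N j) (N j)).image fun m : ℤ => y j + m * d j).filter
      fun a => 0 ≤ a ∧ a < 1) with hS
  have hmem : ∀ j (m : ℤ), 0 ≤ y j + m * d j → y j + m * d j < 1 → y j + m * d j ∈ S j := by
    intro j m h0 h1
    refine Finset.mem_insert_of_mem (Finset.mem_filter.2 ⟨Finset.mem_image.2 ⟨m, ?_, rfl⟩, h0, h1⟩)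
    have hN' : (|y j| + 1) / d j ≤ N j := Int.le_ceil _
    rw [div_le_iff₀ (hd j)] at hN'
    have h2 := le_abs_self (y j)
    have h3 := neg_abs_le (y j)
    rw [Finset.mem_Icc]
    constructor
    · have : -(N j : ℝ) ≤ m := by
        by_contra hcon
        have := mul_lt_mul_of_pos_right (not_le.1 hcon) (hd j)
        linarith
      exact_mod_cast this
    · have : (m : ℝ) ≤ N j := by
        by_contra hcon
        have := mul_lt_mul_of_pos_right (not_le.1 hcon) (hd j)
        linarith
      exact_mod_cast this
  refine ⟨gridPartition S, isPartition_gridPartition (fun j => Finset.mem_insert_self _ _) ?_, ?_⟩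
  · intro j a ha
    rcases Finset.mem_insert.1 ha with rfl | h
    · simp
    · exact (Finset.mem_filter.1 h).2
  · intro c hc
    have hcj := hT c hc
    simp only [shiftBox] at hcj
    rw [mem_gridPartition]
    have hlt : ∀ j, y j + c j * d j < 1 := fun j => by linarith [(hcj j).2, hd j]
    have heq : ∀ j, y j + ((c j + 1 : ℤ) : ℝ) * d j = y j + c j * d j + d j := fun j => by
      push_cast; ring
    refine ⟨fun j => hmem j _ (hcj j).1 (hlt j), fun j => ?_⟩
    simp only [shiftBox]
    refine (nextCut_eq ?_ (by linarith [hd j]) (hcj j).2.le ?_).symm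
    · rw [← heq]
      exact hmem j _ (by rw [heq]; linarith [hd j, (hcj j).1]) (by rw [heq]; exact (hcj j).2)
    · intro a ha hlt'
      rcases Finset.mem_insert.1 ha with rfl | h
      · linarith [(hcj j).1]
      · obtain ⟨m, -, rfl⟩ := Finset.mem_image.1 (Finset.mem_filter.1 h).1
        have h1 : (c j : ℝ) < m := by
          by_contra hcon
          have := mul_le_mul_of_nonneg_right (not_lt.1 hcon) (hd j).le
          linarith
        have h2 : c j + 1 ≤ m := by exact_mod_cast h1
        have h3 : ((c j + 1 : ℤ) : ℝ) ≤ m := by exact_mod_cast h2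
        rw [← heq]
        have := mul_le_mul_of_nonneg_right h3 (hd j).le
        linarith

open Classical in
/-- The modulus `|Δ(g, ∏ⱼ [xⱼ, xⱼ + dⱼ))|` of the increment of `g` at `x` with step `d`, extended
by zero to those `x` for which a vertex lies outside the unit cube. -/
noncomputable def increment {ι : Type*} [Fintype ι] (g : (ι → ℝ) → ℝ) (d x : ι → ℝ) : ℝ≥0∞ :=
  {x : ι → ℝ | ∀ j, 0 ≤ x j ∧ x j + d j < 1}.indicator
    (fun x => ENNReal.ofReal |boxDelta g (x, fun j => x j + d j)|) x

lemma tsum_increment_le {ι : Type*} [Fintype ι] (lam : ℝ) {p : ℝ} (hp : 1 ≤ p)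
    (g : (ι → ℝ) → ℝ) (y d : ι → ℝ) (hd : ∀ j, 0 < d j) :
    ∑' c : ι → ℤ, increment g d (fun j => y j + c j * d j) ≤
      ENNReal.ofReal ((∏ j, d j) ^ (lam - 1)) * vitaliVar lam p g := by
  classical
  have hpos : 0 < ∏ j, d j := Finset.prod_pos fun j _ => hd j
  refine ENNReal.summable.tsum_le_of_sum_le fun T => ?_
  set T' := T.filter fun c => ∀ j, 0 ≤ (shiftBox y d c).1 j ∧ (shiftBox y d c).2 j < 1 with hT'
  obtain ⟨P, hP, hPT⟩ := exists_partition_shiftBox y d hd T' fun c hc => (Finset.mem_filter.1 hc).2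
  have hinj : Set.InjOn (shiftBox y d) T' := by
    intro c _ c' _ h
    funext j
    have := congrFun (congrArg Prod.fst h) j
    simp only [shiftBox] at this
    have h2 : (c j : ℝ) * d j = c' j * d j := by linarith
    exact_mod_cast mul_right_cancel₀ (hd j).ne' h2
  have hvol : ∀ c, boxVol (shiftBox y d c) = ∏ j, d j := fun c => by
    simp [boxVol, shiftBox]
  have key := hP.sum_le_vitaliVar lam hp g (T := T'.image (shiftBox y d))
    (by
      intro J hJ
      obtain ⟨c, hc, rfl⟩ := Finset.mem_image.1 hJ
      exact hPT c hc)
    (by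
      intro J hJ
      obtain ⟨c, hc, rfl⟩ := Finset.mem_image.1 hJ
      exact fun j => ((Finset.mem_filter.1 hc).2 j).2)
  rw [Finset.sum_image hinj] at key
  calc ∑ c ∈ T, increment g d (fun j => y j + c j * d j)
      = ∑ c ∈ T', ENNReal.ofReal |boxDelta g (shiftBox y d c)| := by
        rw [hT', Finset.sum_filter]
        refine Finset.sum_congr rfl fun c _ => ?_
        simp only [increment, Set.indicator_apply, Set.mem_ofPred_eq, shiftBox]
        congr
    _ = ∑ c ∈ T', ENNReal.ofReal ((∏ j, d j) ^ (lam - 1)) *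
        (ENNReal.ofReal (boxVol (shiftBox y d c)) *
          ENNReal.ofReal (|boxDelta g (shiftBox y d c)| / boxVol (shiftBox y d c) ^ lam)) := by
        refine Finset.sum_congr rfl fun c _ => ?_
        rw [hvol, ← ENNReal.ofReal_mul hpos.le, ← ENNReal.ofReal_mul (by positivity)]
        congr 1
        rw [Real.rpow_sub_one hpos.ne']
        have := (Real.rpow_pos_of_pos hpos lam).ne'
        field_simp
    _ ≤ _ := by
        rw [← Finset.mul_sum]
        gcongr

lemma iUnion_shiftBox {ι : Type*} (d : ι → ℝ) (hd : ∀ j, 0 < d j) :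
    ⋃ c : ι → ℤ, box (shiftBox 0 d c).1 (shiftBox 0 d c).2 = Set.univ := by
  refine Set.eq_univ_of_forall fun x => Set.mem_iUnion.2 ⟨fun j => ⌊x j / d j⌋, fun j _ => ?_⟩
  have h1 := Int.floor_le (x j / d j)
  have h2 := Int.lt_floor_add_one (x j / d j)
  rw [le_div_iff₀ (hd j)] at h1
  rw [div_lt_iff₀ (hd j)] at h2
  simp only [shiftBox, Pi.zero_apply, zero_add, Set.mem_Ico]
  exact ⟨h1, by linarith⟩

lemma pairwise_disjoint_shiftBox {ι : Type*} (d : ι → ℝ) (hd : ∀ j, 0 < d j) :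
    Pairwise (Function.onFun Disjoint
      fun c : ι → ℤ => box (shiftBox 0 d c).1 (shiftBox 0 d c).2) := by
  have aux : ∀ (j : ι) (x : ℝ) (m : ℤ), m * d j ≤ x → x < m * d j + d j → m = ⌊x / d j⌋ := by
    intro j x m h1 h2
    rw [eq_comm, Int.floor_eq_iff, le_div_iff₀ (hd j), div_lt_iff₀ (hd j)]
    exact ⟨h1, by linarith⟩
  intro c c' hne
  obtain ⟨j, hj⟩ := Function.ne_iff.1 hne
  refine Set.disjoint_left.2 fun x hx hx' => hj ?_
  have h1 := hx j (Set.mem_univ j)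
  have h2 := hx' j (Set.mem_univ j)
  simp only [shiftBox, Pi.zero_apply, zero_add, Set.mem_Ico] at h1 h2
  rw [aux j _ _ h1.1 h1.2, aux j _ _ h2.1 h2.2]

/-- The space is tiled by the translates of `∏ⱼ [0, dⱼ)` along the lattice with steps `dⱼ`. -/
lemma lintegral_eq_lintegral_tsum_shift {ι : Type*} [Fintype ι] (d : ι → ℝ) (hd : ∀ j, 0 < d j)
    {F : (ι → ℝ) → ℝ≥0∞} (hF : AEMeasurable F) :
    ∫⁻ x, F x = ∫⁻ y in box 0 d, ∑' c : ι → ℤ, F (fun j => y j + c j * d j) := by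
  have hmp : ∀ c : ι → ℤ, MeasurePreserving (fun y : ι → ℝ => y + fun j => (c j : ℝ) * d j)
      volume volume := fun c => measurePreserving_add_right volume _
  rw [lintegral_tsum]
  · rw [← setLIntegral_univ, ← iUnion_shiftBox d hd,
      lintegral_iUnion (fun c => measurableSet_box _ _) (pairwise_disjoint_shiftBox d hd)]
    refine tsum_congr fun c => ?_
    rw [← (hmp c).setLIntegral_comp_preimage_emb (measurableEmbedding_addRight _)]
    congr 2
    ext y
    simp [box, shiftBox, Set.mem_pi, Pi.add_apply, add_comm]
  · intro c
    exact (hF.comp_quasiMeasurePreserving (hmp c).quasiMeasurePreserving).restrict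

/-- Increments of step `d` are of size `∏ⱼ dⱼ^lam` times the variation, in the mean. -/
lemma lintegral_increment_le {ι : Type*} [Fintype ι] (lam : ℝ) {p : ℝ} (hp : 1 ≤ p)
    (g : (ι → ℝ) → ℝ) (d : ι → ℝ) (hd : ∀ j, 0 < d j) (hF : AEMeasurable (increment g d)) :
    ∫⁻ x, increment g d x ≤ ENNReal.ofReal (∏ j, d j ^ lam) * vitaliVar lam p g := by
  have hpos : 0 < ∏ j, d j := Finset.prod_pos fun j _ => hd j
  rw [lintegral_eq_lintegral_tsum_shift d hd hF]
  calc ∫⁻ y in box 0 d, ∑' c : ι → ℤ, increment g d (fun j => y j + c j * d j)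
      ≤ ∫⁻ _ in box 0 d, ENNReal.ofReal ((∏ j, d j) ^ (lam - 1)) * vitaliVar lam p g :=
        lintegral_mono fun y => tsum_increment_le lam hp g y d hd
    _ = ENNReal.ofReal (∏ j, d j ^ lam) * vitaliVar lam p g := by
        rw [lintegral_const, Measure.restrict_apply_univ, volume_box (0, d) hd]
        rw [mul_right_comm, ← ENNReal.ofReal_mul (by positivity)]
        congr 2
        simp only [boxVol, Pi.zero_apply, sub_zero]
        rw [Real.rpow_sub_one hpos.ne', div_mul_cancel₀ _ hpos.ne',
          Real.finsetProd_rpow _ _ fun j _ => (hd j).le]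

/-! ### Pairing a function of bounded variation with oscillating factors -/

/-- The points `z` and `z'` of `[0,1)` lie in the same cell `[c/n, (c+1)/n)`. -/
def SameCell (n : ℕ) (z z' : ℝ) : Prop :=
  z ∈ Set.Ico (0 : ℝ) 1 ∧ z' ∈ Set.Ico (0 : ℝ) 1 ∧ ⌊z * n⌋ = ⌊z' * n⌋

open Classical in
/-- The difference `ξ(z) - ξ(z + d)` if `z` and `z + d` lie in the same cell of length `1/n`, and
zero otherwise. -/
noncomputable def cellDiff (n : ℕ) (ξ : ℝ → ℂ) (d z : ℝ) : ℂ :=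
  if SameCell n z (z + d) then ξ z - ξ (z + d) else 0

lemma measurableSet_sameCell (n : ℕ) : MeasurableSet {w : ℝ × ℝ | SameCell n w.1 w.2} := by
  unfold SameCell
  refine (measurable_fst measurableSet_Ico).inter ((measurable_snd measurableSet_Ico).inter ?_)
  exact measurableSet_eq_fun (Int.measurable_floor.comp (measurable_fst.mul_const _))
    (Int.measurable_floor.comp (measurable_snd.mul_const _))

lemma measurable_cellDiff {α : Type*} [MeasurableSpace α] (n : ℕ) {ξ : ℝ → ℂ}
    (hξ : Measurable ξ) {d z : α → ℝ} (hd : Measurable d) (hz : Measurable z) :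
    Measurable fun a => cellDiff n ξ (d a) (z a) := by
  unfold cellDiff
  refine Measurable.ite ?_ ?_ measurable_const
  · exact (hz.prodMk (hz.add hd)) (measurableSet_sameCell n)
  · exact (hξ.comp hz).sub (hξ.comp (hz.add hd))

lemma norm_cellDiff_le (n : ℕ) {ξ : ℝ → ℂ} {M : ℝ} (hM : ∀ x, ‖ξ x‖ ≤ M) (d z : ℝ) :
    ‖cellDiff n ξ d z‖ ≤ 2 * M := by
  have h0 : 0 ≤ M := (norm_nonneg _).trans (hM 0)
  unfold cellDiff
  split_ifs
  · calc _ ≤ ‖ξ z‖ + ‖ξ (z + d)‖ := norm_sub_le _ _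
      _ ≤ 2 * M := by linarith [hM z, hM (z + d)]
  · simpa using h0

/-- If `ξ` has mean zero on the cells of length `1/n`, it is recovered from its differences within
the cells. -/
lemma integral_cellDiff_sub {n : ℕ} (hn : 0 < n) {ξ : ℝ → ℂ} (hξ : Measurable ξ) {M : ℝ}
    (hM : ∀ x, ‖ξ x‖ ≤ M)
    (hzero : ∀ c : ℕ, c < n → ∫ x in (c / n : ℝ)..((c + 1) / n : ℝ), ξ x = 0)
    {z : ℝ} (hz : z ∈ Set.Ico (0 : ℝ) 1) :
    ∫ d in Set.Ioo (0 : ℝ) (1 / n), (cellDiff n ξ d z - cellDiff n ξ d (z - d)) = ξ z / n := by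
  have hn' : (0 : ℝ) < n := by exact_mod_cast hn
  have hint : ∀ a b : ℝ, IntervalIntegrable ξ volume a b := fun a b =>
    (intervalIntegrable_const (c := M)).mono_fun hξ.aestronglyMeasurable
      (Filter.Eventually.of_forall fun x => (hM x).trans (le_abs_self M))
  obtain ⟨c, hc⟩ : ∃ c : ℕ, (c : ℤ) = ⌊z * n⌋ :=
    ⟨⌊z * n⌋.toNat, Int.toNat_of_nonneg (Int.floor_nonneg.2 (mul_nonneg hz.1 hn'.le))⟩
  set a : ℝ := c / n with ha
  set b : ℝ := (c + 1) / n with hb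
  have hab : b - a = 1 / n := by rw [ha, hb]; field_simp; ring
  have hcell : ∀ x : ℝ, ⌊z * n⌋ = ⌊x * n⌋ ↔ a ≤ x ∧ x < b := by
    intro x
    rw [← hc, eq_comm, Int.floor_eq_iff, ha, hb, div_le_iff₀ hn', lt_div_iff₀ hn']
    push_cast
    rfl
  have hzc := (hcell z).1 rfl
  have hcn : c < n := by
    have h1 : (c : ℝ) < n := by
      have : (c : ℝ) ≤ z * n := by rw [← div_le_iff₀ hn']; exact hzc.1
      nlinarith [hz.2]
    exact_mod_cast h1
  have ha0 : 0 ≤ a := by positivity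
  have hb1 : b ≤ 1 := by
    rw [hb, div_le_one hn']
    exact_mod_cast hcn
  have h1 : ∀ d, 0 < d → (SameCell n z (z + d) ↔ d < b - z) := by
    intro d hd
    unfold SameCell
    rw [hcell]
    constructor
    · intro h; linarith [h.2.2.2]
    · intro h
      exact ⟨hz, ⟨by linarith [hz.1], by linarith⟩, by linarith, by linarith⟩
  have h2 : ∀ d, 0 < d → (SameCell n (z - d) (z - d + d) ↔ d ≤ z - a) := by
    intro d hd
    unfold SameCell
    rw [sub_add_cancel, eq_comm (a := ⌊(z - d) * n⌋), hcell]
    constructor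
    · intro h; linarith [h.2.2.1]
    · intro h
      exact ⟨⟨by linarith, by linarith [hz.2]⟩, hz, by linarith, by linarith⟩
  have e1 : ∫ d in Set.Ioo (0 : ℝ) (1 / n), cellDiff n ξ d z =
      ∫ d in (0 : ℝ)..(b - z), (ξ z - ξ (z + d)) := by
    rw [intervalIntegral.integral_of_le (by linarith), integral_Ioc_eq_integral_Ioo]
    have hI : Set.Ioo (0 : ℝ) (b - z) = Set.Ioo 0 (1 / (n : ℝ)) ∩ Set.Iio (b - z) := by
      ext d
      simp only [Set.mem_Ioo, Set.mem_inter_iff, Set.mem_Iio]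
      constructor
      · intro h; exact ⟨⟨h.1, by linarith⟩, h.2⟩
      · intro h; exact ⟨h.1.1, h.2⟩
    rw [hI, ← setIntegral_indicator measurableSet_Iio]
    refine setIntegral_congr_fun measurableSet_Ioo fun d hd => ?_
    simp only [cellDiff, h1 d hd.1, Set.indicator_apply, Set.mem_Iio]
  have e2 : ∫ d in Set.Ioo (0 : ℝ) (1 / n), cellDiff n ξ d (z - d) =
      ∫ d in (0 : ℝ)..(z - a), (ξ (z - d) - ξ z) := by
    rw [intervalIntegral.integral_of_le (by linarith)]
    have hI : Set.Ioc (0 : ℝ) (z - a) = Set.Ioo 0 (1 / (n : ℝ)) ∩ Set.Iic (z - a) := by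
      ext d
      simp only [Set.mem_Ioo, Set.mem_inter_iff, Set.mem_Iic, Set.mem_Ioc]
      constructor
      · intro h; exact ⟨⟨h.1, by linarith⟩, h.2⟩
      · intro h; exact ⟨h.1.1, h.2⟩
    rw [hI, ← setIntegral_indicator measurableSet_Iic]
    refine setIntegral_congr_fun measurableSet_Ioo fun d hd => ?_
    simp only [cellDiff, h2 d hd.1, Set.indicator_apply, Set.mem_Iic]
    rw [sub_add_cancel]
  have hbd : ∀ f : ℝ → ℂ, Measurable f → (∀ x, ‖f x‖ ≤ 2 * M) →
      IntegrableOn f (Set.Ioo (0 : ℝ) (1 / n)) := fun f hf hfM =>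
    Measure.integrableOn_of_bounded (by simp) hf.aestronglyMeasurable
      (Filter.Eventually.of_forall hfM)
  have hbdd : ∀ {u : ℝ → ℝ} {a b : ℝ}, Measurable u →
      IntervalIntegrable (fun d => ξ (u d)) volume a b := fun hu =>
    (intervalIntegrable_const (c := M)).mono_fun (hξ.comp hu).aestronglyMeasurable
      (Filter.Eventually.of_forall fun x => (hM _).trans (le_abs_self M))
  have i1 : IntegrableOn (fun d => cellDiff n ξ d z) (Set.Ioo (0 : ℝ) (1 / n)) :=
    hbd _ (measurable_cellDiff n hξ measurable_id measurable_const)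
      fun d => norm_cellDiff_le n hM d z
  have i2 : IntegrableOn (fun d => cellDiff n ξ d (z - d)) (Set.Ioo (0 : ℝ) (1 / n)) :=
    hbd _ (measurable_cellDiff n hξ measurable_id (measurable_const.sub measurable_id))
      fun d => norm_cellDiff_le n hM d _
  rw [integral_sub i1 i2, e1, e2,
    intervalIntegral.integral_sub intervalIntegrable_const (hbdd (u := fun d => z + d) (by fun_prop)),
    intervalIntegral.integral_sub (hbdd (u := fun d => z - d) (by fun_prop))
      intervalIntegrable_const,
    intervalIntegral.integral_comp_add_left (fun x => ξ x) z,
    intervalIntegral.integral_comp_sub_left (fun x => ξ x) z]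
  have hadd := intervalIntegral.integral_add_adjacent_intervals (hint a z) (hint z b)
  rw [hzero c hcn] at hadd
  simp only [intervalIntegral.integral_const, sub_zero, add_zero, sub_sub_cancel,
    add_sub_cancel]
  have : (b - z) • ξ z + (z - a) • ξ z = ξ z / n := by
    rw [← add_smul, show b - z + (z - a) = 1 / n by linarith, Complex.real_smul]
    push_cast
    ring
  rw [← this]
  linear_combination -hadd

open Classical in
lemma prod_sub_eq_sum_ite {ι : Type*} [Fintype ι] (a b : ι → ℂ) :
    ∏ j, (a j - b j) = ∑ w : Finset ι, (-1) ^ w.card * ∏ j, if j ∈ w then b j else a j := by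
  rw [Finset.prod_sub, Finset.powerset_univ]
  refine Finset.sum_congr rfl fun w _ => ?_
  rw [mul_assoc, Finset.prod_ite, mul_comm (∏ i ∈ Finset.univ \ w, a i)]
  congr 3 <;> ext j <;> simp

open Classical in
/-- The translation by `d j` in the coordinates `j ∈ w`, which occurs in `boxDelta`. -/
lemma shift_eq_add {ι : Type*} [Fintype ι] (d t : ι → ℝ) (w : Finset ι) :
    (fun j => if j ∈ w then t j + d j else t j) = t + fun j => if j ∈ w then d j else 0 := by
  funext j
  by_cases h : j ∈ w <;> simp [h]

open Classical in
/-- Summation by parts in every coordinate, with step `d`. -/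
lemma integral_mul_prod_cellDiff {ι : Type*} [Fintype ι] {g : (ι → ℝ) → ℝ} (hg : Integrable g)
    (n : ι → ℕ) {ξ : ι → ℝ → ℂ} (hξ : ∀ j, Measurable (ξ j)) {M : ι → ℝ}
    (hM : ∀ j x, ‖ξ j x‖ ≤ M j) (d : ι → ℝ) :
    ∫ z, (g z : ℂ) * ∏ j, (cellDiff (n j) (ξ j) (d j) (z j) -
        cellDiff (n j) (ξ j) (d j) (z j - d j)) =
      ∫ t, (boxDelta g (t, fun j => t j + d j) : ℂ) *
        ∏ j, cellDiff (n j) (ξ j) (d j) (t j) := by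
  set v : Finset ι → ι → ℝ := fun w j => if j ∈ w then d j else 0 with hv
  set Φ : Finset ι → (ι → ℝ) → ℂ := fun w t =>
    (-1) ^ w.card * ((g (t + v w) : ℂ) * ∏ j, cellDiff (n j) (ξ j) (d j) (t j)) with hΦ
  have hmeas : ∀ j, Measurable fun t : ι → ℝ => cellDiff (n j) (ξ j) (d j) (t j) := fun j =>
    measurable_cellDiff (n j) (hξ j) measurable_const (measurable_pi_apply j)
  have hΦint : ∀ w, Integrable (Φ w) := by
    intro w
    refine Integrable.const_mul ?_ _
    refine Integrable.mul_bdd (c := ∏ j, 2 * M j) (hg.comp_add_right (v w)).ofReal ?_ ?_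
    · exact (Finset.measurable_prod _ fun j _ => hmeas j).aestronglyMeasurable
    · refine Filter.Eventually.of_forall fun t => ?_
      rw [norm_prod]
      exact Finset.prod_le_prod (fun _ _ => norm_nonneg _) fun j _ =>
        norm_cellDiff_le (n j) (hM j) _ _
  have hL : ∀ z : ι → ℝ, (g z : ℂ) * ∏ j, (cellDiff (n j) (ξ j) (d j) (z j) -
      cellDiff (n j) (ξ j) (d j) (z j - d j)) = ∑ w, Φ w (z - v w) := by
    intro z
    rw [prod_sub_eq_sum_ite, Finset.mul_sum]
    refine Finset.sum_congr rfl fun w _ => ?_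
    simp only [hΦ, sub_add_cancel]
    rw [mul_left_comm]
    congr 3
    funext j
    by_cases h : j ∈ w <;> simp [hv, h]
  have hR : ∀ t : ι → ℝ, (boxDelta g (t, fun j => t j + d j) : ℂ) *
      ∏ j, cellDiff (n j) (ξ j) (d j) (t j) = ∑ w, Φ w t := by
    intro t
    unfold boxDelta
    push_cast
    rw [Finset.sum_mul]
    refine Finset.sum_congr rfl fun w _ => ?_
    simp only [hΦ, hv, shift_eq_add]
    ring
  simp_rw [hL, hR]
  rw [integral_finsetSum _ fun w _ => (hΦint w).comp_sub_right (v w),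
    integral_finsetSum _ fun w _ => hΦint w]
  exact Finset.sum_congr rfl fun w _ => integral_sub_right_eq_self (Φ w) (v w)

lemma indicator_shift_eq {ι : Type*} {g : (ι → ℝ) → ℝ} {d t : ι → ℝ} (hd : ∀ j, 0 < d j)
    (ht : ∀ j, 0 ≤ t j ∧ t j + d j < 1) {x : ι → ℝ} (hx : ∀ j, x j = t j ∨ x j = t j + d j) :
    (unitCube ι).indicator g x = g x := by
  refine Set.indicator_of_mem ?_ _
  rw [mem_unitCube]
  intro j
  rcases hx j with h | h <;> rw [h] <;> constructor <;> linarith [hd j, (ht j).1, (ht j).2]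

open Classical in
lemma boxDelta_indicator {ι : Type*} [Fintype ι] (g : (ι → ℝ) → ℝ) {d t : ι → ℝ}
    (hd : ∀ j, 0 < d j) (ht : ∀ j, 0 ≤ t j ∧ t j + d j < 1) :
    boxDelta ((unitCube ι).indicator g) (t, fun j => t j + d j) =
      boxDelta g (t, fun j => t j + d j) := by
  unfold boxDelta
  refine Finset.sum_congr rfl fun w _ => ?_
  rw [indicator_shift_eq hd ht]
  intro j
  by_cases h : j ∈ w <;> simp [h]

lemma aemeasurable_increment {ι : Type*} [Fintype ι] {g : (ι → ℝ) → ℝ}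
    (hg : IntegrableOn g (unitCube ι)) {d : ι → ℝ} (hd : ∀ j, 0 < d j) :
    AEMeasurable (increment g d) := by
  classical
  have hg0 : Integrable ((unitCube ι).indicator g) := hg.integrable_indicator
    (measurableSet_unitCube ι)
  have hset : MeasurableSet {x : ι → ℝ | ∀ j, 0 ≤ x j ∧ x j + d j < 1} := by
    rw [Set.ofPred_forall]
    exact MeasurableSet.iInter fun j => (measurableSet_le measurable_const
      (measurable_pi_apply j)).inter (measurableSet_lt ((measurable_pi_apply j).add_const _)
        measurable_const)
  have heq : increment g d = {x : ι → ℝ | ∀ j, 0 ≤ x j ∧ x j + d j < 1}.indicator fun x =>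
      ENNReal.ofReal |boxDelta ((unitCube ι).indicator g) (x, fun j => x j + d j)| := by
    funext x
    unfold increment
    by_cases hx : x ∈ {x : ι → ℝ | ∀ j, 0 ≤ x j ∧ x j + d j < 1}
    · rw [Set.indicator_of_mem hx, Set.indicator_of_mem hx]
      congr 2
      convert (boxDelta_indicator g hd hx).symm
    · rw [Set.indicator_of_notMem hx, Set.indicator_of_notMem hx]
  rw [heq]
  refine AEMeasurable.indicator ?_ hset
  refine ENNReal.measurable_ofReal.comp_aemeasurable
    (measurable_norm.comp_aemeasurable (g := fun r : ℝ => ‖r‖) ?_)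
  unfold boxDelta
  refine Finset.aemeasurable_fun_sum _ fun w _ => AEMeasurable.const_mul ?_ _
  simp only [shift_eq_add]
  exact (hg0.comp_add_right _).aemeasurable

/-- For a fixed step `d`, the integral against differences of `ξ` is controlled by the increments of
`g` of step `d`. -/
lemma enorm_integral_mul_prod_cellDiff_le {ι : Type*} [Fintype ι] (lam : ℝ) {p : ℝ} (hp : 1 ≤ p)
    {g : (ι → ℝ) → ℝ} (hg : IntegrableOn g (unitCube ι))
    (n : ι → ℕ) {ξ : ι → ℝ → ℂ} (hξ : ∀ j, Measurable (ξ j)) {M : ι → ℝ}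
    (hM : ∀ j x, ‖ξ j x‖ ≤ M j) {d : ι → ℝ} (hd : ∀ j, 0 < d j) :
    ‖∫ z, (((unitCube ι).indicator g z : ℝ) : ℂ) * ∏ j, (cellDiff (n j) (ξ j) (d j) (z j) -
        cellDiff (n j) (ξ j) (d j) (z j - d j))‖ₑ ≤
      ENNReal.ofReal (∏ j, 2 * M j) * (ENNReal.ofReal (∏ j, d j ^ lam) * vitaliVar lam p g) := by
  classical
  have hg0 : Integrable ((unitCube ι).indicator g) := hg.integrable_indicator
    (measurableSet_unitCube ι)
  rw [integral_mul_prod_cellDiff hg0 n hξ hM d]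
  refine (enorm_integral_le_lintegral_enorm _).trans ?_
  refine le_trans ?_ (mul_le_mul_right
    (lintegral_increment_le lam hp g d hd (aemeasurable_increment hg hd)) _)
  rw [← lintegral_const_mul' _ _ ENNReal.ofReal_ne_top]
  refine lintegral_mono fun t => ?_
  unfold increment
  by_cases ht : ∀ j, 0 ≤ t j ∧ t j + d j < 1
  · rw [Set.indicator_of_mem (show t ∈ {x : ι → ℝ | ∀ j, 0 ≤ x j ∧ x j + d j < 1} from ht),
      boxDelta_indicator g hd ht, enorm_mul, mul_comm]
    refine mul_le_mul' ?_ ?_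
    · rw [← ofReal_norm, norm_prod]
      exact ENNReal.ofReal_le_ofReal (Finset.prod_le_prod (fun _ _ => norm_nonneg _) fun j _ =>
        norm_cellDiff_le (n j) (hM j) _ _)
    · rw [← ofReal_norm, Complex.norm_real, Real.norm_eq_abs]
  · push Not at ht
    obtain ⟨j, hj⟩ := ht
    have : cellDiff (n j) (ξ j) (d j) (t j) = 0 := by
      unfold cellDiff
      rw [if_neg]
      rintro ⟨h1, h2, -⟩
      exact absurd h2.2 (not_lt.2 (hj h1.1))
    rw [Finset.prod_eq_zero (Finset.mem_univ j) this]
    simp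

/-- A function of bounded variation integrated against a product of factors that oscillate on cells
of lengths `1 / n j` gains the factor `∏ⱼ (1 / n j) ^ lam`. -/
lemma enorm_setIntegral_mul_prod_le {ι : Type*} [Fintype ι] {lam p : ℝ} (hlam : 0 < lam)
    (hp : 1 ≤ p) {g : (ι → ℝ) → ℝ} (hg : IntegrableOn g (unitCube ι))
    {n : ι → ℕ} (hn : ∀ j, 0 < n j) {ξ : ι → ℝ → ℂ} (hξ : ∀ j, Measurable (ξ j)) {M : ι → ℝ}
    (hM : ∀ j x, ‖ξ j x‖ ≤ M j)
    (hzero : ∀ j, ∀ c : ℕ, c < n j → ∫ x in (c / n j : ℝ)..((c + 1) / n j : ℝ), ξ j x = 0) :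
    ‖∫ x in unitCube ι, (g x : ℂ) * ∏ j, ξ j (x j)‖ₑ ≤
      ENNReal.ofReal (∏ j, 2 * M j * (1 / n j : ℝ) ^ lam) * vitaliVar lam p g := by
  classical
  have hg0 : Integrable ((unitCube ι).indicator g) := hg.integrable_indicator
    (measurableSet_unitCube ι)
  have hn' : ∀ j, (0 : ℝ) < n j := fun j => by exact_mod_cast hn j
  have hM0 : ∀ j, 0 ≤ M j := fun j => (norm_nonneg _).trans (hM j 0)
  set D : Set (ι → ℝ) := Set.univ.pi fun j => Set.Ioo (0 : ℝ) (1 / n j) with hD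
  have hDmeas : MeasurableSet D := MeasurableSet.univ_pi fun _ => measurableSet_Ioo
  have hDvol : volume D = ENNReal.ofReal (∏ j, (1 / n j : ℝ)) := by
    rw [hD, Real.volume_pi_Ioo, ENNReal.ofReal_prod_of_nonneg fun j _ => by positivity]
    simp
  set κ : ι → ℝ → ℝ → ℂ := fun j z d =>
    cellDiff (n j) (ξ j) d z - cellDiff (n j) (ξ j) d (z - d) with hκ
  have hκmeas : ∀ j, Measurable fun w : ℝ × ℝ => κ j w.1 w.2 := fun j =>
    (measurable_cellDiff (n j) (hξ j) measurable_snd measurable_fst).sub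
      (measurable_cellDiff (n j) (hξ j) measurable_snd (measurable_fst.sub measurable_snd))
  have hκM : ∀ j z d, ‖κ j z d‖ ≤ 4 * M j := fun j z d =>
    calc _ ≤ ‖cellDiff (n j) (ξ j) d z‖ + ‖cellDiff (n j) (ξ j) d (z - d)‖ := norm_sub_le _ _
      _ ≤ 4 * M j := by
        linarith [norm_cellDiff_le (n j) (hM j) d z, norm_cellDiff_le (n j) (hM j) d (z - d)]
  have hκint : ∀ z ∈ unitCube ι,
      ∫ d in D, ∏ j, κ j (z j) (d j) = ∏ j, (ξ j (z j) / n j) := by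
    intro z hz
    rw [hD, volume_pi, Measure.restrict_pi_pi,
      integral_fintype_prod_eq_prod (fun j d => κ j (z j) d)]
    exact Finset.prod_congr rfl fun j _ => integral_cellDiff_sub (hn j) (hξ j) (hM j) (hzero j)
      (mem_unitCube.1 hz j)
  have hfin : IsFiniteMeasure (volume.restrict D) := ⟨by
    rw [Measure.restrict_apply_univ, hDvol]; exact ENNReal.ofReal_lt_top⟩
  set Φ : (ι → ℝ) × (ι → ℝ) → ℂ := fun w =>
    (((unitCube ι).indicator g w.1 : ℝ) : ℂ) * ∏ j, κ j (w.1 j) (w.2 j) with hΦ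
  have hΦint : Integrable Φ (volume.prod (volume.restrict D)) := by
    have hg1 : Integrable (fun z => (((unitCube ι).indicator g z : ℝ) : ℂ)) := hg0.ofReal
    refine Integrable.mul_bdd (c := ∏ j, 4 * M j) (hg1.comp_fst (volume.restrict D)) ?_ ?_
    · refine (Finset.measurable_prod _ fun j _ => ?_).aestronglyMeasurable
      have hpair : Measurable fun w : (ι → ℝ) × (ι → ℝ) => (w.1 j, w.2 j) := by fun_prop
      exact (hκmeas j).comp hpair
    · refine Filter.Eventually.of_forall fun w => ?_
      rw [norm_prod]
      exact Finset.prod_le_prod (fun _ _ => norm_nonneg _) fun j _ => hκM j _ _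
  have hscaled : ((∏ j, (1 / n j : ℝ) : ℝ) : ℂ) * ∫ x in unitCube ι, (g x : ℂ) * ∏ j, ξ j (x j) =
      ∫ d in D, ∫ z, Φ (z, d) := by
    rw [integral_integral_swap (f := fun d z => Φ (z, d)) hΦint.swap,
      ← integral_indicator (measurableSet_unitCube ι), ← integral_const_mul]
    refine integral_congr_ae (Filter.Eventually.of_forall fun z => ?_)
    change ((∏ j, (1 / n j : ℝ) : ℝ) : ℂ) *
      (unitCube ι).indicator (fun x => (g x : ℂ) * ∏ j, ξ j (x j)) z =
        ∫ d in D, (((unitCube ι).indicator g z : ℝ) : ℂ) * ∏ j, κ j (z j) (d j)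
    rw [integral_const_mul]
    by_cases hz : z ∈ unitCube ι
    · rw [hκint z hz, Set.indicator_of_mem hz, Set.indicator_of_mem hz]
      have hprod : ((∏ j, (1 / n j : ℝ) : ℝ) : ℂ) = (∏ j, (n j : ℂ))⁻¹ := by
        push_cast
        simp
      rw [hprod, Finset.prod_div_distrib]
      ring
    · simp [hz]
  have hbound : ‖∫ d in D, ∫ z, Φ (z, d)‖ₑ ≤
      ENNReal.ofReal (∏ j, (1 / n j : ℝ)) *
        (ENNReal.ofReal (∏ j, 2 * M j * (1 / n j : ℝ) ^ lam) * vitaliVar lam p g) := by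
    refine (enorm_integral_le_lintegral_enorm _).trans ?_
    calc ∫⁻ d in D, ‖∫ z, Φ (z, d)‖ₑ
        ≤ ∫⁻ _ in D, ENNReal.ofReal (∏ j, 2 * M j * (1 / n j : ℝ) ^ lam) * vitaliVar lam p g := by
          refine setLIntegral_mono' hDmeas fun d hd => ?_
          have hd' : ∀ j, 0 < d j ∧ d j < 1 / n j := fun j => hd j (Set.mem_univ j)
          refine (enorm_integral_mul_prod_cellDiff_le lam hp hg n hξ hM
            fun j => (hd' j).1).trans ?_
          rw [← mul_assoc, ← ENNReal.ofReal_mul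
            (Finset.prod_nonneg fun j _ => by linarith [hM0 j]), ← Finset.prod_mul_distrib]
          refine mul_le_mul_left (ENNReal.ofReal_le_ofReal (Finset.prod_le_prod
            (fun j _ => ?_) fun j _ => ?_)) _
          · exact mul_nonneg (by linarith [hM0 j]) (Real.rpow_nonneg (hd' j).1.le _)
          · exact mul_le_mul_of_nonneg_left (Real.rpow_le_rpow (hd' j).1.le (hd' j).2.le hlam.le)
              (by linarith [hM0 j])
      _ = _ := by
          rw [lintegral_const, Measure.restrict_apply_univ, hDvol, mul_comm]
  have hpos : 0 < ∏ j, (1 / n j : ℝ) := Finset.prod_pos fun j _ => by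
    have := hn' j
    positivity
  rw [← hscaled, enorm_mul, ← ofReal_norm, Complex.norm_real, Real.norm_of_nonneg hpos.le]
    at hbound
  exact (ENNReal.mul_le_mul_iff_right (ENNReal.ofReal_pos.2 hpos).ne' ENNReal.ofReal_ne_top).1 hbound

/-! ### The Hardy and Krause variation and averaging over coordinates -/

lemma restrict_unitCube (ι : Type*) [Fintype ι] :
    (volume : Measure (ι → ℝ)).restrict (unitCube ι) =
      Measure.pi fun _ : ι => (volume : Measure ℝ).restrict (Set.Ico 0 1) := by
  unfold unitCube box
  rw [volume_pi, Measure.restrict_pi_pi]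

instance : IsProbabilityMeasure ((volume : Measure ℝ).restrict (Set.Ico 0 1)) := ⟨by simp⟩

lemma vitaliVar_le_hardyKrauseVar {ι : Type*} [Fintype ι] (lam p : ℝ) {q : ℝ} (hq : 1 ≤ q)
    {g : (ι → ℝ) → ℝ} (hg : IntegrableOn g (unitCube ι)) (w : Finset ι) :
    vitaliVar lam p (proj g w) ≤ hardyKrauseVar lam p q g := by
  have hq0 : q ≠ 0 := by linarith
  unfold hardyKrauseVar
  rw [if_pos hg]
  calc vitaliVar lam p (proj g w) = (vitaliVar lam p (proj g w) ^ q) ^ (1 / q) := by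
        rw [← ENNReal.rpow_mul, mul_one_div_cancel hq0, ENNReal.rpow_one]
    _ ≤ _ := by
        refine ENNReal.rpow_le_rpow ?_ (by positivity)
        exact Finset.single_le_sum (f := fun w => vitaliVar lam p (proj g w) ^ q)
          (fun _ _ => zero_le) (Finset.mem_univ w)

open Classical in
lemma prod_add_eq_sum_ite {ι : Type*} [Fintype ι] (a b : ι → ℂ) :
    ∏ j, (a j + b j) = ∑ w : Finset ι, ∏ j, if j ∈ w then b j else a j := by
  have h := prod_sub_eq_sum_ite a fun j => -b j
  simp only [sub_neg_eq_add] at h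
  rw [h]
  refine Finset.sum_congr rfl fun w _ => ?_
  have : ∀ j, (if j ∈ w then -b j else a j) =
      (if j ∈ w then -1 else 1) * if j ∈ w then b j else a j := fun j => by
    split_ifs <;> simp
  simp_rw [this, Finset.prod_mul_distrib, Finset.prod_ite_mem, Finset.univ_inter,
    Finset.prod_const, ← mul_assoc, ← mul_pow]
  simp

open Classical in
/-- Constant factors in the coordinates outside `w` replace `g` by its projection. -/
lemma setIntegral_mul_prod_ite {ι : Type*} [Fintype ι] {g : (ι → ℝ) → ℝ}
    (hg : IntegrableOn g (unitCube ι)) (w : Finset ι) {ξ : ι → ℝ → ℂ}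
    (hξ : ∀ j, Measurable (ξ j)) {M : ι → ℝ} (hM : ∀ j x, ‖ξ j x‖ ≤ M j) (m : ι → ℂ) :
    IntegrableOn (proj g w) (unitCube {j // j ∈ w}) ∧
    ∫ x in unitCube ι, (g x : ℂ) * ∏ j, (if j ∈ w then ξ j (x j) else m j) =
      (∏ j : {j // j ∉ w}, m j) *
        ∫ x in unitCube {j // j ∈ w}, (proj g w x : ℂ) * ∏ j : {j // j ∈ w}, ξ j (x j) := by
  set e := (MeasurableEquiv.piEquivPiSubtypeProd (fun _ : ι => ℝ) (· ∈ w)).symm with he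
  have hmp : MeasurePreserving e ((Measure.pi fun _ : {j // j ∈ w} =>
      (volume : Measure ℝ).restrict (Set.Ico 0 1)).prod (Measure.pi fun _ : {j // j ∉ w} =>
      (volume : Measure ℝ).restrict (Set.Ico 0 1)))
      (Measure.pi fun _ : ι => (volume : Measure ℝ).restrict (Set.Ico 0 1)) := by
    convert (measurePreserving_piEquivPiSubtypeProd
      (fun _ : ι => (volume : Measure ℝ).restrict (Set.Ico 0 1)) (· ∈ w)).symm
  have hsplit : ∀ f : ι → ℂ,
      ∏ j, f j = (∏ j : {j // j ∈ w}, f j) * ∏ j : {j // j ∉ w}, f j := by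
    intro f
    convert (Fintype.prod_subtype_mul_prod_subtype (· ∈ w) f).symm
  have hg1 : Integrable (fun z => g (e z)) ((Measure.pi fun _ : {j // j ∈ w} =>
      (volume : Measure ℝ).restrict (Set.Ico 0 1)).prod (Measure.pi fun _ : {j // j ∉ w} =>
      (volume : Measure ℝ).restrict (Set.Ico 0 1))) := by
    rw [IntegrableOn, restrict_unitCube] at hg
    exact hmp.integrable_comp_of_integrable hg
  have hproj : ∀ x, proj g w x = ∫ y, g (e (x, y)) ∂(Measure.pi fun _ : {j // j ∉ w} =>
      (volume : Measure ℝ).restrict (Set.Ico 0 1)) := by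
    intro x
    unfold proj
    rw [restrict_unitCube]
    rfl
  refine ⟨?_, ?_⟩
  · rw [IntegrableOn, restrict_unitCube]
    simp_rw [funext hproj]
    exact hg1.integral_prod_left
  · rw [restrict_unitCube, restrict_unitCube, ← hmp.integral_comp']
    have hF : ∀ z : ({j // j ∈ w} → ℝ) × ({j // j ∉ w} → ℝ),
        (g (e z) : ℂ) * ∏ j, (if j ∈ w then ξ j (e z j) else m j) =
        (g (e z) : ℂ) * ((∏ j : {j // j ∉ w}, m j) * ∏ j : {j // j ∈ w}, ξ j (z.1 j)) := by
      intro z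
      rw [hsplit, mul_comm (∏ j : {j // j ∉ w}, m j)]
      congr 2
      · refine Finset.prod_congr rfl fun j _ => ?_
        rw [if_pos j.2, he]
        simp [MeasurableEquiv.piEquivPiSubtypeProd, Equiv.piEquivPiSubtypeProd]
      · refine Finset.prod_congr rfl fun j _ => if_neg j.2
    simp_rw [hF]
    rw [integral_prod, ← integral_const_mul]
    · refine integral_congr_ae (Filter.Eventually.of_forall fun x => ?_)
      simp only [hproj]
      rw [integral_mul_const, integral_complex_ofReal]
      ring
    · have hg2 : Integrable (fun z => (g (e z) : ℂ)) ((Measure.pi fun _ : {j // j ∈ w} =>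
          (volume : Measure ℝ).restrict (Set.Ico 0 1)).prod (Measure.pi fun _ : {j // j ∉ w} =>
          (volume : Measure ℝ).restrict (Set.Ico 0 1))) := hg1.ofReal
      have hmeas : Measurable fun z : ({j // j ∈ w} → ℝ) × ({j // j ∉ w} → ℝ) =>
          ∏ j : {j // j ∈ w}, ξ j (z.1 j) := Finset.measurable_prod _ fun j _ =>
        (hξ j).comp ((measurable_pi_apply j).comp measurable_fst)
      refine hg2.mul_bdd (c := ‖∏ j : {j // j ∉ w}, m j‖ * ∏ j : {j // j ∈ w}, M j)
        (hmeas.const_mul _).aestronglyMeasurable (Filter.Eventually.of_forall fun z => ?_)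
      · rw [norm_mul, norm_prod (f := fun j : {j // j ∈ w} => ξ j (z.1 j))]
        exact mul_le_mul_of_nonneg_left (Finset.prod_le_prod (fun _ _ => norm_nonneg _)
          fun j _ => hM j _) (norm_nonneg _)

/-- The factors may be arbitrary in those coordinates where no oscillation is claimed: splitting off
their means leads to the projections of `g`. -/
lemma enorm_setIntegral_mul_prod_le_hardyKrauseVar {ι : Type*} [Fintype ι] {lam p q : ℝ}
    (hlam : 0 < lam) (hp : 1 ≤ p) (hq : 1 ≤ q) {g : (ι → ℝ) → ℝ}
    (hg : IntegrableOn g (unitCube ι))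
    {n : ι → ℕ} (hn : ∀ j, 0 < n j) {χ : ι → ℝ → ℂ} (hχ : ∀ j, Measurable (χ j)) {M : ι → ℝ}
    (hM : ∀ j x, ‖χ j x‖ ≤ M j)
    (hzero : ∀ j, n j = 1 ∨
      ∀ c : ℕ, c < n j → ∫ x in (c / n j : ℝ)..((c + 1) / n j : ℝ), χ j x = 0) :
    ‖∫ x in unitCube ι, (g x : ℂ) * ∏ j, χ j (x j)‖ₑ ≤
      ENNReal.ofReal (∏ j, 8 * (M j * (1 / n j : ℝ) ^ lam)) * hardyKrauseVar lam p q g := by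
  classical
  have hn' : ∀ j, (0 : ℝ) < n j := fun j => by exact_mod_cast hn j
  have hM0 : ∀ j, 0 ≤ M j := fun j => (norm_nonneg _).trans (hM j 0)
  have hint : ∀ j (a b : ℝ), IntervalIntegrable (χ j) volume a b := fun j a b =>
    (intervalIntegrable_const (c := M j)).mono_fun (hχ j).aestronglyMeasurable
      (Filter.Eventually.of_forall fun x => (hM j x).trans (le_abs_self _))
  set m : ι → ℂ := fun j => ∫ x in (0 : ℝ)..1, χ j x with hm
  set ξ : ι → ℝ → ℂ := fun j x => χ j x - m j with hξ
  have hmM : ∀ j, ‖m j‖ ≤ M j := fun j => by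
    simpa using intervalIntegral.norm_integral_le_of_norm_le_const (a := 0) (b := 1)
      fun x _ => hM j x
  have hm0 : ∀ j, n j = 1 ∨ m j = 0 := by
    intro j
    refine (hzero j).imp_right fun h => ?_
    have hsum := intervalIntegral.sum_integral_adjacent_intervals (f := χ j) (μ := volume)
      (a := fun c : ℕ => (c / n j : ℝ)) (n := n j) fun c _ => hint j _ _
    rw [Finset.sum_eq_zero] at hsum
    · simpa [hm, (hn' j).ne'] using hsum.symm
    · intro c hc
      simpa using h c (Finset.mem_range.1 hc)
  have hξM : ∀ j x, ‖ξ j x‖ ≤ 2 * M j := fun j x => (norm_sub_le _ _).trans (by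
    linarith [hM j x, hmM j])
  have hξmeas : ∀ j, Measurable (ξ j) := fun j => (hχ j).sub_const _
  have hξzero : ∀ j, ∀ c : ℕ, c < n j →
      ∫ x in (c / n j : ℝ)..((c + 1) / n j : ℝ), ξ j x = 0 := by
    intro j c hc
    simp only [hξ]
    rw [intervalIntegral.integral_sub (hint j _ _) intervalIntegrable_const,
      intervalIntegral.integral_const]
    rcases hm0 j with h1 | h0
    · have hc0 : c = 0 := by omega
      simp [h1, hc0, hm]
    · rcases hzero j with h1 | h
      · have hc0 : c = 0 := by omega
        simp [h1, hc0, hm]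
      · rw [h c hc, h0]
        simp
  have hexp : ∀ x : ι → ℝ, (g x : ℂ) * ∏ j, χ j (x j) =
      ∑ w : Finset ι, (g x : ℂ) * ∏ j, if j ∈ w then ξ j (x j) else m j := by
    intro x
    rw [← Finset.mul_sum, ← prod_add_eq_sum_ite]
    simp [hξ]
  have hterm : ∀ w : Finset ι,
      ‖∫ x in unitCube ι, (g x : ℂ) * ∏ j, if j ∈ w then ξ j (x j) else m j‖ₑ ≤
        ENNReal.ofReal (∏ j, 4 * (M j * (1 / n j : ℝ) ^ lam)) * hardyKrauseVar lam p q g := by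
    intro w
    obtain ⟨hi, heq⟩ := setIntegral_mul_prod_ite hg w hξmeas hξM m
    rw [heq, enorm_mul]
    have h1 := enorm_setIntegral_mul_prod_le hlam hp hi (n := fun j => n j) (fun j => hn j)
      (ξ := fun j => ξ j) (fun j => hξmeas j) (M := fun j => 2 * M j) (fun j => hξM j)
      fun j => hξzero j
    refine (mul_le_mul_right (h1.trans (mul_le_mul_right
      (vitaliVar_le_hardyKrauseVar lam p hq hg w) _)) _).trans ?_
    rw [← mul_assoc, ← ofReal_norm, norm_prod, ← ENNReal.ofReal_mul
      (Finset.prod_nonneg fun _ _ => norm_nonneg _)]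
    refine mul_le_mul_left (ENNReal.ofReal_le_ofReal ?_) _
    have hsplit : ∀ f : ι → ℝ,
        ∏ j, f j = (∏ j : {j // j ∈ w}, f j) * ∏ j : {j // j ∉ w}, f j := by
      intro f
      convert (Fintype.prod_subtype_mul_prod_subtype (· ∈ w) f).symm
    rw [hsplit, mul_comm]
    refine mul_le_mul (le_of_eq ?_) (Finset.prod_le_prod (fun _ _ => norm_nonneg _) fun j _ => ?_)
      (Finset.prod_nonneg fun _ _ => norm_nonneg _) (Finset.prod_nonneg fun j _ => ?_)
    · exact Finset.prod_congr rfl fun j _ => by ring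
    · rcases hm0 j with h | h
      · rw [h]
        simpa using (hmM j).trans (by linarith [hM0 j])
      · rw [h, norm_zero]
        have := hM0 j
        positivity
    · have := hM0 j
      positivity
  simp_rw [hexp]
  rw [integral_finsetSum]
  · refine (enorm_sum_le _ _).trans ((Finset.sum_le_sum fun w _ => hterm w).trans (le_of_eq ?_))
    rw [Finset.sum_const, Finset.card_univ, Fintype.card_finset, nsmul_eq_mul, ← mul_assoc]
    congr 1
    have h84 : ∀ j, 8 * (M j * (1 / n j : ℝ) ^ lam) = 2 * (4 * (M j * (1 / n j : ℝ) ^ lam)) :=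
      fun j => by ring
    simp_rw [h84]
    rw [Finset.prod_mul_distrib (f := fun _ => (2 : ℝ)), Finset.prod_const, Finset.card_univ,
      ENNReal.ofReal_mul (by positivity), ENNReal.ofReal_pow (by norm_num)]
    congr 1
    norm_num
  · intro w _
    refine Integrable.mul_bdd (c := ∏ j, 2 * M j) hg.ofReal ?_
      (Filter.Eventually.of_forall fun x => ?_)
    · refine (Finset.measurable_prod _ fun j _ => ?_).aestronglyMeasurable
      by_cases h : j ∈ w
      · simp only [h, if_true]
        exact (hξmeas j).comp (measurable_pi_apply j)
      · simp [h]
    · rw [norm_prod]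
      refine Finset.prod_le_prod (fun _ _ => norm_nonneg _) fun j _ => ?_
      split_ifs
      · exact hξM j _
      · linarith [hmM j, hM0 j]

/-! ### Taylor's formula with integral remainder in several variables -/

/-- The measure against which a derivative of order `i` enters Taylor's formula of order `δ`:
Lebesgue measure on `[0,1)` for the remainder, `i = δ`, and the point mass at `0` otherwise. -/
noncomputable def axisMeasure (δ i : ℕ) : Measure ℝ :=
  if i = δ then volume.restrict (Set.Ico 0 1) else Measure.dirac 0

instance (δ i : ℕ) : IsProbabilityMeasure (axisMeasure δ i) := by
  unfold axisMeasure
  split_ifs <;> infer_instance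

/-- The kernel of Taylor's formula at the point `x`: the monomial `x ^ i / i!` for `i ≠ δ`, and
the remainder kernel `(x - t)₊ ^ (δ - 1) / (δ - 1)!` for `i = δ`. -/
noncomputable def taylorKernel (δ i : ℕ) (x t : ℝ) : ℝ :=
  if i = δ then (if 0 ≤ t ∧ t ≤ x then (x - t) ^ (δ - 1) / (δ - 1).factorial else 0)
  else x ^ i / i.factorial

lemma ae_axisMeasure (δ i : ℕ) : ∀ᵐ t ∂axisMeasure δ i, t ∈ Set.Ico (0 : ℝ) 1 := by
  unfold axisMeasure
  split_ifs
  · exact ae_restrict_mem measurableSet_Ico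
  · rw [ae_dirac_eq]
    simp

lemma measurable_taylorKernel (δ i : ℕ) {α : Type*} [MeasurableSpace α] {x t : α → ℝ}
    (hx : Measurable x) (ht : Measurable t) : Measurable fun a => taylorKernel δ i (x a) (t a) := by
  unfold taylorKernel
  split_ifs
  · exact Measurable.ite ((measurableSet_le measurable_const ht).inter (measurableSet_le ht hx))
      (((hx.sub ht).pow_const _).div_const _) measurable_const
  · exact (hx.pow_const _).div_const _

lemma pow_div_factorial_mem_Icc {x : ℝ} (h0 : 0 ≤ x) (h1 : x ≤ 1) (m : ℕ) :
    x ^ m / m.factorial ∈ Set.Icc (0 : ℝ) 1 := by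
  have hm : (1 : ℝ) ≤ m.factorial := by exact_mod_cast m.factorial_pos
  refine ⟨by positivity, ?_⟩
  rw [div_le_one (by positivity)]
  exact (pow_le_one₀ h0 h1).trans hm

lemma norm_taylorKernel_le (δ i : ℕ) {x : ℝ} (hx : x ∈ Set.Ico (0 : ℝ) 1) (t : ℝ) :
    ‖taylorKernel δ i x t‖ ≤ 1 := by
  have h : taylorKernel δ i x t ∈ Set.Icc (0 : ℝ) 1 := by
    unfold taylorKernel
    split_ifs with h1 h2
    · exact pow_div_factorial_mem_Icc (by linarith) (by linarith [hx.2]) _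
    · simp
    · exact pow_div_factorial_mem_Icc hx.1 hx.2.le _
  rw [Real.norm_of_nonneg h.1]
  exact h.2

lemma hasDerivWithinAt_taylorSum {h : ℕ → ℝ → ℝ} {S : Set ℝ} {t : ℝ} (y : ℝ) (m : ℕ)
    (hd : ∀ i ≤ m, HasDerivWithinAt (h i) (h (i + 1) t) S t) :
    HasDerivWithinAt (fun t => ∑ i ∈ Finset.range (m + 1), h i t * ((y - t) ^ i / i.factorial))
      (h (m + 1) t * ((y - t) ^ m / m.factorial)) S t := by
  induction m with
  | zero => simpa using hd 0 le_rfl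
  | succ m ih =>
    simp only [Finset.sum_range_succ _ (m + 1)]
    have h1 := ih fun i hi => hd i (by omega)
    have h2 : HasDerivWithinAt (fun t : ℝ => (y - t) ^ (m + 1) / (m + 1).factorial)
        (-((y - t) ^ m / m.factorial)) S t := by
      have := ((((hasDerivAt_id t).const_sub y).pow (m + 1)).div_const
        ((m + 1).factorial : ℝ)).hasDerivWithinAt (s := S)
      refine this.congr_deriv ?_
      have hf : (m.factorial : ℝ) ≠ 0 := by exact_mod_cast m.factorial_ne_zero
      rw [Nat.factorial_succ]
      push_cast
      simp only [id]
      field_simp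
    refine (h1.add ((hd (m + 1) le_rfl).mul h2)).congr_deriv ?_
    ring

lemma eq_sum_integral_taylorKernel {δ : ℕ} (hδ : 1 ≤ δ) {h : ℕ → ℝ → ℝ}
    (hd : ∀ i < δ, ∀ t ∈ Set.Ico (0 : ℝ) 1, HasDerivWithinAt (h i) (h (i + 1) t) (Set.Ico 0 1) t)
    (hint : Integrable (h δ) (axisMeasure δ δ)) {y : ℝ} (hy : y ∈ Set.Ico (0 : ℝ) 1) :
    h 0 y = ∑ i ∈ Finset.range (δ + 1), ∫ t, h i t * taylorKernel δ i y t ∂axisMeasure δ i := by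
  obtain ⟨m, rfl⟩ : ∃ m, δ = m + 1 := ⟨δ - 1, by omega⟩
  set Φ : ℝ → ℝ := fun t => ∑ i ∈ Finset.range (m + 1), h i t * ((y - t) ^ i / i.factorial)
    with hΦ
  have hder : ∀ t ∈ Set.Ico (0 : ℝ) 1, HasDerivWithinAt Φ
      (h (m + 1) t * ((y - t) ^ m / m.factorial)) (Set.Ico 0 1) t := fun t ht =>
    hasDerivWithinAt_taylorSum y m fun i hi => hd i (by omega) t ht
  have hsub : Set.Icc 0 y ⊆ Set.Ico (0 : ℝ) 1 := fun t ht => ⟨ht.1, ht.2.trans_lt hy.2⟩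
  have hint' : IntegrableOn (h (m + 1)) (Set.Ico 0 1) := by
    simpa [axisMeasure, IntegrableOn] using hint
  have hFTC : ∫ t in (0 : ℝ)..y, h (m + 1) t * ((y - t) ^ m / m.factorial) = Φ y - Φ 0 := by
    refine intervalIntegral.integral_eq_sub_of_hasDerivAt_of_le hy.1
      (fun t ht => (hder t (hsub ht)).continuousWithinAt.mono hsub) (fun t ht => ?_) ?_
    · exact (hder t (hsub (Set.Ioo_subset_Icc_self ht))).hasDerivAt
        (Ico_mem_nhds ht.1 (ht.2.trans hy.2))
    · refine IntervalIntegrable.mul_continuousOn ?_ (by fun_prop)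
      rw [intervalIntegrable_iff_integrableOn_Icc_of_le hy.1]
      exact hint'.mono_set hsub
  have hΦy : Φ y = h 0 y := by
    simp only [hΦ, sub_self]
    rw [Finset.sum_eq_single 0]
    · simp
    · intro i _ hi
      simp [hi]
    · simp
  have hΦ0 : Φ 0 = ∑ i ∈ Finset.range (m + 1),
      ∫ t, h i t * taylorKernel (m + 1) i y t ∂axisMeasure (m + 1) i := by
    refine Finset.sum_congr rfl fun i hi => ?_
    have hi' : i ≠ m + 1 := (Finset.mem_range.1 hi).ne
    simp [axisMeasure, taylorKernel, hi']
  have hrem : ∫ t, h (m + 1) t * taylorKernel (m + 1) (m + 1) y t ∂axisMeasure (m + 1) (m + 1) =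
      ∫ t in (0 : ℝ)..y, h (m + 1) t * ((y - t) ^ m / m.factorial) := by
    rw [intervalIntegral.integral_of_le hy.1, ← integral_Icc_eq_integral_Ioc]
    have hI : Set.Icc 0 y = Set.Ico (0 : ℝ) 1 ∩ Set.Icc 0 y :=
      (Set.inter_eq_right.2 hsub).symm
    rw [hI, ← setIntegral_indicator measurableSet_Icc]
    simp only [axisMeasure, if_true]
    refine setIntegral_congr_fun measurableSet_Ico fun t ht => ?_
    simp only [taylorKernel, if_true, Set.indicator_apply, Set.mem_Icc, Nat.add_sub_cancel]
    split_ifs <;> simp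
  rw [Finset.sum_range_succ, hrem, hFTC, ← hΦ0, hΦy]
  ring

/-! ### Splitting off the last variable -/

lemma iterate_partialDeriv_snoc {s : ℕ} (j : Fin s) (m : ℕ) (g : (Fin (s + 1) → ℝ) → ℝ) (t : ℝ) :
    (fun y => ((partialDeriv j.castSucc)^[m] g) (Fin.snoc (α := fun _ => ℝ) y t)) =
      (partialDeriv j)^[m] fun y => g (Fin.snoc (α := fun _ => ℝ) y t) := by
  induction m with
  | zero => rfl
  | succ m ih =>
    rw [Function.iterate_succ_apply', Function.iterate_succ_apply', ← ih]
    funext y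
    simp only [partialDeriv, Fin.snoc_castSucc, ← Fin.snoc_update]

lemma foldr_partialDeriv_snoc {s : ℕ} (l : List (Fin s)) (τ : Fin (s + 1) → ℕ)
    (g : (Fin (s + 1) → ℝ) → ℝ) (t : ℝ) :
    (fun y => (((l.map Fin.castSucc).foldr (fun j g => (partialDeriv j)^[τ j] g) g)
      (Fin.snoc (α := fun _ => ℝ) y t))) =
      l.foldr (fun j g => (partialDeriv j)^[τ j.castSucc] g)
        fun y => g (Fin.snoc (α := fun _ => ℝ) y t) := by
  induction l with
  | nil => rfl
  | cons j l ih =>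
    simp only [List.map_cons, List.foldr_cons]
    rw [iterate_partialDeriv_snoc, ih]

/-- The function `∂ₛ^i f(·, t)` of the first `s` variables. -/
noncomputable def slice {s : ℕ} (f : (Fin (s + 1) → ℝ) → ℝ) (i : ℕ) (t : ℝ) :
    (Fin s → ℝ) → ℝ := fun y =>
  ((partialDeriv (Fin.last s))^[i] f) (Fin.snoc (α := fun _ => ℝ) y t)

lemma mixedDeriv_snoc {s : ℕ} (f : (Fin (s + 1) → ℝ) → ℝ) (τ : Fin s → ℕ) (i : ℕ)
    (y : Fin s → ℝ) (t : ℝ) :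
    mixedDeriv f (Fin.snoc (α := fun _ => ℕ) τ i) (Fin.snoc (α := fun _ => ℝ) y t) =
      mixedDeriv (slice f i t) τ y := by
  have h := congrFun (foldr_partialDeriv_snoc (List.finRange s)
    (Fin.snoc (α := fun _ => ℕ) τ i) ((partialDeriv (Fin.last s))^[i] f) t) y
  simp only [Fin.snoc_castSucc] at h
  unfold mixedDeriv slice
  rw [← h, List.finRange_succ_last, List.foldr_append]
  simp

lemma mixedDeriv_zero {s : ℕ} (f : (Fin s → ℝ) → ℝ) : mixedDeriv f (fun _ => 0) = f := by
  unfold mixedDeriv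
  simp only [Function.iterate_zero, id]
  induction List.finRange s <;> simp_all

lemma snoc_mem_unitCube {s : ℕ} {y : Fin s → ℝ} {t : ℝ} (hy : y ∈ unitCube (Fin s))
    (ht : t ∈ Set.Ico (0 : ℝ) 1) :
    Fin.snoc (α := fun _ => ℝ) y t ∈ unitCube (Fin (s + 1)) := by
  rw [mem_unitCube] at hy ⊢
  intro j
  refine Fin.lastCases ?_ (fun j => ?_) j
  · simpa using ht
  · simpa using hy j

lemma HasMixedDerivs.slice {s δ : ℕ} {f : (Fin (s + 1) → ℝ) → ℝ} (hf : HasMixedDerivs δ f)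
    {i : ℕ} (hi : i ≤ δ) {t : ℝ} (ht : t ∈ Set.Ico (0 : ℝ) 1) :
    HasMixedDerivs δ (slice f i t) := by
  intro τ hτ j hj hj0 y hy
  have h := hf (Fin.snoc (α := fun _ => ℕ) τ i)
    (fun k => Fin.lastCases (by simpa using hi) (fun k => by simpa using hτ k) k) j.castSucc
    (by simpa using hj)
    (fun k => Fin.lastCases (fun hk => absurd hk (not_lt.2 (Fin.le_last _)))
      (fun k hk => by simpa using hj0 k (by simpa using hk)) k) _ (snoc_mem_unitCube hy ht)
  simpa only [Fin.snoc_castSucc, ← Fin.snoc_update, mixedDeriv_snoc] using h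

lemma HasMixedDerivs.hasDerivWithinAt_slice {s δ : ℕ} {f : (Fin (s + 1) → ℝ) → ℝ}
    (hf : HasMixedDerivs δ f) {i : ℕ} (hi : i < δ) {y : Fin s → ℝ} (hy : y ∈ unitCube (Fin s))
    {t : ℝ} (ht : t ∈ Set.Ico (0 : ℝ) 1) :
    HasDerivWithinAt (fun t => WalshDecay.slice f i t y) (WalshDecay.slice f (i + 1) t y)
      (Set.Ico 0 1) t := by
  have h := hf (Fin.snoc (α := fun _ => ℕ) (fun _ => 0) i)
    (fun k => Fin.lastCases (by simpa using hi.le) (fun k => by simp) k) (Fin.last s)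
    (by simpa using hi)
    (fun k => Fin.lastCases (fun hk => absurd hk (lt_irrefl _)) (fun k hk => by simp) k) _
    (snoc_mem_unitCube hy ht)
  simp only [Fin.update_snoc_last, Fin.snoc_last, mixedDeriv_snoc, mixedDeriv_zero] at h
  refine h.hasDerivWithinAt.congr_deriv ?_
  simp only [WalshDecay.slice, Function.iterate_succ_apply', partialDeriv, Fin.update_snoc_last,
    Fin.snoc_last]

lemma measurableEmbedding_snoc (s : ℕ) : MeasurableEmbedding
    fun w : ℝ × (Fin s → ℝ) => Fin.snoc (α := fun _ => ℝ) w.2 w.1 := by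
  convert (MeasurableEquiv.piFinSuccAbove (fun _ : Fin (s + 1) => ℝ)
    (Fin.last s)).symm.measurableEmbedding using 1
  funext w
  exact (Fin.insertNth_last' w.1 w.2).symm

lemma measurePreserving_snoc {s : ℕ} (δ : ℕ) (τ : Fin s → ℕ) (i : ℕ) : MeasurePreserving
    (fun w : ℝ × (Fin s → ℝ) => Fin.snoc (α := fun _ => ℝ) w.2 w.1)
    ((axisMeasure δ i).prod (Measure.pi fun j => axisMeasure δ (τ j)))
    (Measure.pi fun j => axisMeasure δ (Fin.snoc (α := fun _ => ℕ) τ i j)) := by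
  have h := (measurePreserving_piFinSuccAbove (fun j : Fin (s + 1) =>
    axisMeasure δ (Fin.snoc (α := fun _ => ℕ) τ i j)) (Fin.last s)).symm
  simp only [Fin.succAbove_last, Fin.snoc_last, Fin.snoc_castSucc] at h
  convert h using 1
  funext w
  exact (Fin.insertNth_last' w.1 w.2).symm

lemma sum_piFinset_snoc {s : ℕ} (δ : ℕ) (F : (Fin (s + 1) → ℕ) → ℝ) :
    ∑ τ ∈ Fintype.piFinset fun _ : Fin (s + 1) => Finset.range (δ + 1), F τ =
      ∑ i ∈ Finset.range (δ + 1), ∑ τ ∈ Fintype.piFinset fun _ : Fin s => Finset.range (δ + 1),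
        F (Fin.snoc (α := fun _ => ℕ) τ i) := by
  rw [← Finset.sum_product']
  refine (Finset.sum_nbij' (fun p => Fin.snoc (α := fun _ => ℕ) p.2 p.1)
    (fun τ => (τ (Fin.last s), Fin.init τ)) ?_ ?_ ?_ ?_ ?_).symm
  · rintro ⟨i, τ⟩ h
    simp only [Finset.mem_product, Fintype.mem_piFinset] at h ⊢
    intro k
    refine Fin.lastCases ?_ (fun k => ?_) k
    · simpa using h.1
    · simpa using h.2 k
  · intro τ h
    simp only [Finset.mem_product, Fintype.mem_piFinset] at h ⊢
    exact ⟨h _, fun k => h _⟩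
  · rintro ⟨i, τ⟩ _
    simp
  · intro τ _
    simp
  · intros
    rfl

lemma norm_prod_taylorKernel_le {s : ℕ} (δ : ℕ) (τ : Fin s → ℕ) {x : Fin s → ℝ}
    (hx : x ∈ unitCube (Fin s)) (t : Fin s → ℝ) :
    ‖∏ j, taylorKernel δ (τ j) (x j) (t j)‖ ≤ 1 := by
  rw [norm_prod]
  exact Finset.prod_le_one (fun _ _ => norm_nonneg _) fun j _ =>
    norm_taylorKernel_le _ _ (mem_unitCube.1 hx j) _

/-- Taylor's formula needs integrability only of the functions `f^(τ)(·, 0)`: for almost every value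
`t` of the last variable the formula in the other variables holds, and it exhibits `∂ₛ^δ f(y, t)`, for
every fixed `y`, as an integrable function of `t`. -/
theorem eq_sum_integral_mixedDeriv {δ : ℕ} (hδ : 1 ≤ δ) :
    ∀ (s : ℕ) (f : (Fin s → ℝ) → ℝ), HasMixedDerivs δ f →
      (∀ τ ∈ Fintype.piFinset fun _ : Fin s => Finset.range (δ + 1),
        Integrable (mixedDeriv f τ) (Measure.pi fun j => axisMeasure δ (τ j))) →
      ∀ x ∈ unitCube (Fin s), f x =
        ∑ τ ∈ Fintype.piFinset fun _ : Fin s => Finset.range (δ + 1),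
          ∫ t, mixedDeriv f τ t * ∏ j, taylorKernel δ (τ j) (x j) (t j)
            ∂Measure.pi fun j => axisMeasure δ (τ j) := by
  intro s
  induction s with
  | zero =>
    intro f _ _ x _
    have hx : ∀ t : Fin 0 → ℝ, t = x := fun t => Subsingleton.elim _ _
    have h0 : ∀ τ : Fin 0 → ℕ, mixedDeriv f τ = f := fun τ => by
      rw [Subsingleton.elim τ fun _ => 0, mixedDeriv_zero]
    simp only [h0, Finset.univ_eq_empty, Finset.prod_empty, mul_one]
    rw [Finset.sum_eq_card_nsmul (b := f x)]
    · simp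
    · intro τ _
      simp only [hx]
      simp
  | succ s ih =>
    intro f hf hint x hx
    obtain ⟨y, r, rfl⟩ : ∃ (y : Fin s → ℝ) (r : ℝ), Fin.snoc (α := fun _ => ℝ) y r = x :=
      ⟨Fin.init x, x (Fin.last s), Fin.snoc_init_self x⟩
    have hr : r ∈ Set.Ico (0 : ℝ) 1 := by simpa using mem_unitCube.1 hx (Fin.last s)
    have hy : y ∈ unitCube (Fin s) :=
      mem_unitCube.2 fun j => by simpa using mem_unitCube.1 hx j.castSucc
    set T := Fintype.piFinset fun _ : Fin s => Finset.range (δ + 1) with hT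
    have hprod : ∀ i ∈ Finset.range (δ + 1), ∀ τ ∈ T,
        Integrable (fun w : ℝ × (Fin s → ℝ) => mixedDeriv (slice f i w.1) τ w.2)
          ((axisMeasure δ i).prod (Measure.pi fun j => axisMeasure δ (τ j))) := by
      intro i hi τ hτ
      have h := hint (Fin.snoc (α := fun _ => ℕ) τ i) (by
        rw [Fintype.mem_piFinset] at hτ ⊢
        exact fun k => Fin.lastCases (by simpa using hi) (fun k => by simpa using hτ k) k)
      have h' := ((measurePreserving_snoc δ τ i).integrable_comp_emb
        (measurableEmbedding_snoc s)).2 h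
      exact h'.congr (Filter.Eventually.of_forall fun w => mixedDeriv_snoc f τ i w.2 w.1)
    have hprodK : ∀ i ∈ Finset.range (δ + 1), ∀ τ ∈ T,
        Integrable (fun w : ℝ × (Fin s → ℝ) => mixedDeriv (slice f i w.1) τ w.2 *
          ∏ j, taylorKernel δ (τ j) (y j) (w.2 j))
          ((axisMeasure δ i).prod (Measure.pi fun j => axisMeasure δ (τ j))) := by
      intro i hi τ hτ
      refine (hprod i hi τ hτ).mul_bdd (c := 1) ?_
        (Filter.Eventually.of_forall fun w => norm_prod_taylorKernel_le δ τ hy _)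
      exact (Finset.measurable_prod _ fun j _ => measurable_taylorKernel δ (τ j) measurable_const
        ((measurable_pi_apply j).comp measurable_snd)).aestronglyMeasurable
    set A : (Fin s → ℕ) → ℕ → ℝ → ℝ := fun τ i t =>
      ∫ u, mixedDeriv (slice f i t) τ u * ∏ j, taylorKernel δ (τ j) (y j) (u j)
        ∂Measure.pi fun j => axisMeasure δ (τ j) with hA
    have hAint : ∀ i ∈ Finset.range (δ + 1), ∀ τ ∈ T, Integrable (A τ i) (axisMeasure δ i) :=
      fun i hi τ hτ => (hprodK i hi τ hτ).integral_prod_left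
    have hae : ∀ i ∈ Finset.range (δ + 1),
        ∀ᵐ t ∂axisMeasure δ i, slice f i t y = ∑ τ ∈ T, A τ i t := by
      intro i hi
      have h1 : ∀ᵐ t ∂axisMeasure δ i, ∀ τ ∈ T, Integrable (mixedDeriv (slice f i t) τ)
          (Measure.pi fun j => axisMeasure δ (τ j)) := by
        rw [Filter.eventually_all_finset]
        exact fun τ hτ => (hprod i hi τ hτ).prod_right_ae
      filter_upwards [h1, ae_axisMeasure δ i] with t ht1 ht2
      exact ih (slice f i t) (hf.slice (Nat.lt_succ_iff.1 (Finset.mem_range.1 hi)) ht2) ht1 y hy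
    have htaylor := eq_sum_integral_taylorKernel hδ (h := fun i t => slice f i t y)
      (fun i hi t ht => hf.hasDerivWithinAt_slice hi hy ht)
      ((integrable_finsetSum T fun τ hτ => hAint δ (by simp) τ hτ).congr
        ((hae δ (by simp)).mono fun t ht => ht.symm)) hr
    have hslice0 : f (Fin.snoc (α := fun _ => ℝ) y r) = slice f 0 r y := rfl
    rw [hslice0, htaylor, sum_piFinset_snoc]
    refine Finset.sum_congr rfl fun i hi => ?_
    have hterm : ∀ t, (∑ τ ∈ T, A τ i t) * taylorKernel δ i r t =
        ∑ τ ∈ T, A τ i t * taylorKernel δ i r t := fun t => Finset.sum_mul _ _ _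
    rw [integral_congr_ae ((hae i hi).mono fun t ht => by
      simp only [ht]; exact hterm t), integral_finsetSum]
    · refine Finset.sum_congr rfl fun τ hτ => ?_
      rw [← (measurePreserving_snoc δ τ i).integral_comp (measurableEmbedding_snoc s),
        integral_prod]
      · refine integral_congr_ae (Filter.Eventually.of_forall fun t => ?_)
        simp only [hA]
        rw [← integral_mul_const]
        refine integral_congr_ae (Filter.Eventually.of_forall fun u => ?_)
        simp only [mixedDeriv_snoc, Fin.prod_univ_castSucc, Fin.snoc_castSucc, Fin.snoc_last]
        ring
      · refine ((hprodK i hi τ hτ).mul_bdd (c := 1) (g := fun w => taylorKernel δ i r w.1)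
          (measurable_taylorKernel δ i measurable_const measurable_fst).aestronglyMeasurable
          (Filter.Eventually.of_forall fun w => norm_taylorKernel_le δ i hr _)).congr
          (Filter.Eventually.of_forall fun w => ?_)
        simp only [mixedDeriv_snoc, Fin.prod_univ_castSucc, Fin.snoc_castSucc, Fin.snoc_last]
        ring
    · intro τ hτ
      exact (hAint i hi τ hτ).mul_bdd (c := 1)
        (measurable_taylorKernel δ i measurable_const measurable_id).aestronglyMeasurable
        (Filter.Eventually.of_forall fun t => norm_taylorKernel_le δ i hr _)

/-! ### Iterated primitives -/

/-- The primitive `∫_t^1 ψ` of `ψ` that vanishes at `1`. -/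
noncomputable def tailInt (ψ : ℝ → ℂ) (t : ℝ) : ℂ := ∫ x in t..1, ψ x

lemma intervalIntegrable_of_bounded {ψ : ℝ → ℂ} (hψ : Measurable ψ) {M : ℝ}
    (hM : ∀ x, ‖ψ x‖ ≤ M) (a b : ℝ) : IntervalIntegrable ψ volume a b :=
  (intervalIntegrable_const (c := M)).mono_fun hψ.aestronglyMeasurable
    (Filter.Eventually.of_forall fun x => (hM x).trans (le_abs_self M))

lemma continuous_tailInt {ψ : ℝ → ℂ} (h : ∀ a b, IntervalIntegrable ψ volume a b) :
    Continuous (tailInt ψ) := by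
  have : tailInt ψ = fun t => -∫ x in (1 : ℝ)..t, ψ x :=
    funext fun t => intervalIntegral.integral_symm _ _
  rw [this]
  exact (intervalIntegral.continuous_primitive h 1).neg

lemma continuous_tailInt_iterate {ψ : ℝ → ℂ} (h : ∀ a b, IntervalIntegrable ψ volume a b)
    (m : ℕ) : Continuous (tailInt^[m + 1] ψ) := by
  induction m generalizing ψ with
  | zero => exact continuous_tailInt h
  | succ m ih =>
    rw [Function.iterate_succ_apply]
    exact ih fun a b => (continuous_tailInt h).intervalIntegrable a b

/-- Exchanging the order of integration over the triangle `t < y < x ≤ 1`. -/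
lemma integral_mul_tailInt {ψ : ℝ → ℂ} (h : ∀ a b, IntervalIntegrable ψ volume a b)
    {k K : ℝ → ℝ} {t : ℝ} (ht : t ≤ 1) (hk : Continuous k)
    (hK : ∀ x, ∫ y in t..x, k y = K x) :
    ∫ y in t..1, (k y : ℂ) * tailInt ψ y = ∫ x in t..1, (K x : ℂ) * ψ x := by
  set F : ℝ → ℝ → ℂ := fun y x => {w : ℝ × ℝ | w.1 < w.2}.indicator
    (fun w => (k w.1 : ℂ) * ψ w.2) (y, x) with hF
  have hkc : Continuous fun y => (k y : ℂ) := by fun_prop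
  have hFint : Integrable (Function.uncurry F) ((volume.restrict (Set.Ioc t 1)).prod
      (volume.restrict (Set.Ioc t 1))) := by
    have h1 : Integrable (fun y => (k y : ℂ)) (volume.restrict (Set.Ioc t 1)) :=
      (hkc.intervalIntegrable t 1).1
    have h2 : Integrable ψ (volume.restrict (Set.Ioc t 1)) := (h t 1).1
    exact (h1.mul_prod h2).indicator (measurableSet_lt measurable_fst measurable_snd)
  rw [intervalIntegral.integral_of_le ht, intervalIntegral.integral_of_le ht]
  have e1 : ∀ y ∈ Set.Ioc t 1, (k y : ℂ) * tailInt ψ y = ∫ x in Set.Ioc t 1, F y x := by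
    intro y hy
    have hI : Set.Ioc y 1 = Set.Ioc t 1 ∩ Set.Ioi y := by
      ext x
      simp only [Set.mem_Ioc, Set.mem_inter_iff, Set.mem_Ioi]
      constructor
      · intro hx; exact ⟨⟨hy.1.trans hx.1, hx.2⟩, hx.1⟩
      · intro hx; exact ⟨hx.2, hx.1.2⟩
    rw [tailInt, intervalIntegral.integral_of_le hy.2, hI, ← setIntegral_indicator measurableSet_Ioi,
      ← integral_const_mul]
    refine integral_congr_ae (Filter.Eventually.of_forall fun x => ?_)
    by_cases hx : y < x <;> simp [hF, hx]
  have e2 : ∀ x ∈ Set.Ioc t 1, (K x : ℂ) * ψ x = ∫ y in Set.Ioc t 1, F y x := by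
    intro x hx
    have hI : Set.Ioo t x = Set.Ioc t 1 ∩ Set.Iio x := by
      ext y
      simp only [Set.mem_Ioc, Set.mem_inter_iff, Set.mem_Iio, Set.mem_Ioo]
      constructor
      · intro hy; exact ⟨⟨hy.1, hy.2.le.trans hx.2⟩, hy.2⟩
      · intro hy; exact ⟨hy.1.1, hy.2⟩
    rw [← hK x, intervalIntegral.integral_of_le hx.1.le, integral_Ioc_eq_integral_Ioo,
      ← integral_complex_ofReal, hI, ← setIntegral_indicator measurableSet_Iio,
      ← integral_mul_const]
    refine integral_congr_ae (Filter.Eventually.of_forall fun y => ?_)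
    by_cases hy : y < x <;> simp [hF, hy]
  rw [setIntegral_congr_fun measurableSet_Ioc e1, setIntegral_congr_fun measurableSet_Ioc e2]
  exact integral_integral_swap hFint

/-- Cauchy's formula for repeated integration. -/
lemma tailInt_iterate_eq {ψ : ℝ → ℂ} (h : ∀ a b, IntervalIntegrable ψ volume a b) (m : ℕ) {t : ℝ}
    (ht : t ≤ 1) :
    tailInt^[m + 1] ψ t = ∫ x in t..1, (((x - t) ^ m / m.factorial : ℝ) : ℂ) * ψ x := by
  induction m generalizing ψ with
  | zero => simp [tailInt]
  | succ m ih =>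
    rw [Function.iterate_succ_apply, ih fun a b => (continuous_tailInt h).intervalIntegrable a b]
    refine integral_mul_tailInt h ht (by fun_prop) fun x => ?_
    rw [intervalIntegral.integral_div, intervalIntegral.integral_comp_sub_right (fun y => y ^ m) t,
      integral_pow, Nat.factorial_succ]
    push_cast
    have : (m.factorial : ℝ) ≠ 0 := by exact_mod_cast m.factorial_ne_zero
    have : (m : ℝ) + 1 ≠ 0 := by positivity
    simp
    field_simp

/-! ### Products of functions of digits -/

/-- A function of a base `q` digit with mean zero, extended periodically to the integers. -/
structure IsDigitFactor (q : ℕ) (e : ℤ → ℂ) : Prop where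
  add_base : ∀ c, e (c + q) = e c
  sum_eq_zero : ∑ c ∈ Finset.range q, e c = 0
  norm_le_one : ∀ c, ‖e c‖ ≤ 1

/-- The product over `a ∈ L` of functions `e a` of the `a`-th digit `⌊x q^a⌋ mod q` of `x`. -/
noncomputable def digitProd (q : ℕ) (e : ℕ → ℤ → ℂ) (L : List ℕ) (x : ℝ) : ℂ :=
  (L.map fun a => e a ⌊x * q ^ a⌋).prod

lemma measurable_digitProd (q : ℕ) (e : ℕ → ℤ → ℂ) (L : List ℕ) :
    Measurable (digitProd q e L) := by
  unfold digitProd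
  induction L with
  | nil => simp
  | cons a L ih =>
    simp only [List.map_cons, List.prod_cons]
    exact ((measurable_from_top (f := e a)).comp
      (Int.measurable_floor.comp (measurable_id.mul_const _))).mul ih

lemma norm_digitProd_le {q : ℕ} {e : ℕ → ℤ → ℂ} {L : List ℕ}
    (he : ∀ a ∈ L, IsDigitFactor q (e a)) (x : ℝ) : ‖digitProd q e L x‖ ≤ 1 := by
  unfold digitProd
  induction L with
  | nil => simp
  | cons a L ih =>
    simp only [List.map_cons, List.prod_cons, norm_mul]
    exact mul_le_one₀ ((he a (by simp)).norm_le_one _) (norm_nonneg _)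
      (ih fun b hb => he b (by simp [hb]))

/-- The `m`-th cell of `x` determines its digits up to the `m`-th. -/
lemma digitProd_congr {q : ℕ} (hq : 0 < q) (e : ℕ → ℤ → ℂ) {L : List ℕ} {m : ℕ}
    (hL : ∀ b ∈ L, b ≤ m) {x y : ℝ} (h : ⌊x * q ^ m⌋ = ⌊y * q ^ m⌋) :
    digitProd q e L x = digitProd q e L y := by
  unfold digitProd
  congr 1
  refine List.map_congr_left fun b hb => ?_
  have hq' : (q : ℝ) ≠ 0 := by exact_mod_cast hq.ne'
  have key : ∀ z : ℝ, ⌊z * q ^ b⌋ = ⌊z * q ^ m⌋ / ((q ^ (m - b) : ℕ) : ℤ) := by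
    intro z
    rw [← Int.floor_div_natCast]
    congr 1
    push_cast
    rw [eq_div_iff (by positivity), mul_assoc, ← pow_add, Nat.add_sub_cancel' (hL b hb)]
  rw [key, key, h]

section Periodic

variable {q m : ℕ} {e : ℤ → ℂ} {B : ℝ → ℂ} {M : ℝ}

lemma inv_pow_eq_mul (hq : 0 < q) (m : ℕ) : ((q : ℝ) ^ m)⁻¹ = q * ((q : ℝ) ^ (m + 1))⁻¹ := by
  have hq' : (q : ℝ) ≠ 0 := by exact_mod_cast hq.ne'
  field_simp
  ring

lemma measurable_digit_mul (e : ℤ → ℂ) (hB : Measurable B) (a : ℕ) :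
    Measurable fun x : ℝ => e ⌊x * q ^ a⌋ * B x :=
  ((measurable_from_top (f := e)).comp
    (Int.measurable_floor.comp (measurable_id.mul_const _))).mul hB

lemma norm_digit_mul_le (he : IsDigitFactor q e) (hM : ∀ x, ‖B x‖ ≤ M) (a : ℕ) (x : ℝ) :
    ‖e ⌊x * q ^ a⌋ * B x‖ ≤ M := by
  rw [norm_mul]
  have := mul_le_mul (he.norm_le_one ⌊x * q ^ a⌋) (hM x) (norm_nonneg _) zero_le_one
  simpa using this

lemma periodic_digit_mul (hq : 0 < q) (he : IsDigitFactor q e)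
    (hper : Function.Periodic B ((q : ℝ) ^ (m + 1))⁻¹) :
    Function.Periodic (fun x : ℝ => e ⌊x * q ^ (m + 1)⌋ * B x) ((q : ℝ) ^ m)⁻¹ := by
  intro x
  have hq' : (q : ℝ) ≠ 0 := by exact_mod_cast hq.ne'
  have h1 : (x + ((q : ℝ) ^ m)⁻¹) * q ^ (m + 1) = x * q ^ (m + 1) + q := by
    rw [add_mul, pow_succ (q : ℝ) m, ← mul_assoc (((q : ℝ) ^ m)⁻¹), inv_mul_cancel₀ (by positivity),
      one_mul]
  have h2 : B (x + ((q : ℝ) ^ m)⁻¹) = B x := by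
    rw [inv_pow_eq_mul hq m]
    exact hper.nat_mul q x
  simp only [h1, h2, Int.floor_add_natCast, he.add_base]

/-- The integral of a periodic function times a digit function of mean zero over a cell of the next
coarser level vanishes. -/
lemma integral_digit_mul_eq_zero (hq : 0 < q) (he : IsDigitFactor q e) (hB : Measurable B)
    (hM : ∀ x, ‖B x‖ ≤ M) (hper : Function.Periodic B ((q : ℝ) ^ (m + 1))⁻¹) :
    ∫ x in (0 : ℝ)..((q : ℝ) ^ m)⁻¹, e ⌊x * q ^ (m + 1)⌋ * B x = 0 := by
  have hq' : (0 : ℝ) < q := by exact_mod_cast hq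
  set d : ℝ := ((q : ℝ) ^ (m + 1))⁻¹ with hd
  have hd0 : 0 < d := by positivity
  have hsum := intervalIntegral.sum_integral_adjacent_intervals
    (f := fun x : ℝ => e ⌊x * q ^ (m + 1)⌋ * B x) (μ := volume)
    (a := fun c : ℕ => (c : ℝ) * d) (n := q) fun c _ =>
      intervalIntegrable_of_bounded (measurable_digit_mul e hB (m + 1))
        (norm_digit_mul_le he hM (m + 1)) _ _
  simp only [Nat.cast_zero, zero_mul] at hsum
  rw [inv_pow_eq_mul hq m, ← hsum]
  have hpiece : ∀ c : ℕ, ∫ x in ((c : ℝ) * d)..(((c + 1 : ℕ) : ℝ) * d),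
      e ⌊x * q ^ (m + 1)⌋ * B x = e c * ∫ x in (0 : ℝ)..d, B x := by
    intro c
    have hle : (c : ℝ) * d ≤ ((c + 1 : ℕ) : ℝ) * d := by
      push_cast; nlinarith
    rw [intervalIntegral.integral_congr_Ioo_of_le hle (g := fun x => e c * B x)]
    · rw [intervalIntegral.integral_const_mul]
      congr 1
      have := hper.intervalIntegral_add_eq ((c : ℝ) * d) 0
      rw [zero_add] at this
      rw [← this]
      congr 1
      push_cast
      ring
    · intro x hx
      have : ⌊x * q ^ (m + 1)⌋ = (c : ℤ) := by
        rw [Int.floor_eq_iff]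
        have h1 := hx.1
        have h2 := hx.2
        rw [hd, ← div_eq_mul_inv, div_lt_iff₀ (by positivity)] at h1
        rw [hd, ← div_eq_mul_inv, lt_div_iff₀ (by positivity)] at h2
        push_cast at h2 ⊢
        exact ⟨h1.le, h2⟩
      simp only [this]
  simp only [hpiece]
  rw [← Finset.sum_mul, he.sum_eq_zero, zero_mul]

lemma periodic_primitive {F : ℝ → ℂ} {T : ℝ} (hF : Function.Periodic F T)
    (hint : ∀ a b, IntervalIntegrable F volume a b) (h0 : ∫ x in (0 : ℝ)..T, F x = 0) :
    Function.Periodic (fun x => ∫ y in (0 : ℝ)..x, F y) T := by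
  intro x
  change ∫ y in (0 : ℝ)..(x + T), F y = ∫ y in (0 : ℝ)..x, F y
  rw [← intervalIntegral.integral_add_adjacent_intervals (hint 0 x) (hint x (x + T)),
    hF.intervalIntegral_add_eq x 0, zero_add, h0, add_zero]

lemma norm_primitive_le {F : ℝ → ℂ} {T : ℝ} (hT : 0 < T) (hM : ∀ x, ‖F x‖ ≤ M)
    (hper : Function.Periodic (fun x => ∫ y in (0 : ℝ)..x, F y) T) (x : ℝ) :
    ‖∫ y in (0 : ℝ)..x, F y‖ ≤ M * T := by
  have hM0 : 0 ≤ M := (norm_nonneg _).trans (hM 0)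
  obtain ⟨y, hy, hxy⟩ := hper.exists_mem_Ico₀ hT x
  change ∫ z in (0 : ℝ)..x, F z = ∫ z in (0 : ℝ)..y, F z at hxy
  rw [hxy]
  have h1 := intervalIntegral.norm_integral_le_of_norm_le_const (a := 0) (b := y)
    fun z _ => hM z
  rw [sub_zero, abs_of_nonneg hy.1] at h1
  exact h1.trans (mul_le_mul_of_nonneg_left hy.2.le hM0)

end Periodic

/-- On `[0,1)` the function `ψ` is the product of functions of the digits `a ∈ L` and of a factor
bounded by `M` that has period `q^(-a)` for all `a ∈ L`. -/
def IsModulated (q : ℕ) (e : ℕ → ℤ → ℂ) (L : List ℕ) (M : ℝ) (ψ : ℝ → ℂ) : Prop :=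
  ∃ B : ℝ → ℂ, Measurable B ∧ (∀ x, ‖B x‖ ≤ M) ∧
    (∀ a ∈ L, Function.Periodic B ((q : ℝ) ^ a)⁻¹) ∧
    ∀ x ∈ Set.Ico (0 : ℝ) 1, ψ x = digitProd q e L x * B x

section Modulated

variable {q : ℕ} {e : ℕ → ℤ → ℂ} {L : List ℕ} {M : ℝ} {ψ : ℝ → ℂ}

lemma IsModulated.norm_le (h : IsModulated q e L M ψ) (he : ∀ a ∈ L, IsDigitFactor q (e a))
    {x : ℝ} (hx : x ∈ Set.Ico (0 : ℝ) 1) : ‖ψ x‖ ≤ M := by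
  obtain ⟨B, -, hM, -, hB⟩ := h
  rw [hB x hx, norm_mul]
  have := mul_le_mul (norm_digitProd_le he x) (hM x) (norm_nonneg _) zero_le_one
  simpa using this

lemma IsModulated.norm_tailInt_le (h : IsModulated q e L M ψ)
    (he : ∀ a ∈ L, IsDigitFactor q (e a)) {x : ℝ} (hx : x ∈ Set.Ico (0 : ℝ) 1) :
    ‖tailInt ψ x‖ ≤ M := by
  have hM0 : 0 ≤ M := (norm_nonneg _).trans (h.norm_le he (x := 0) (by simp))
  have h1 : tailInt ψ x = ∫ y in x..1, (Set.Ico (0 : ℝ) 1).indicator ψ y :=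
    intervalIntegral.integral_congr_Ioo_of_le hx.2.le fun y hy =>
      (Set.indicator_of_mem (show y ∈ Set.Ico (0 : ℝ) 1 from ⟨hx.1.trans hy.1.le, hy.2⟩) ψ).symm
  rw [h1]
  have h2 := intervalIntegral.norm_integral_le_of_norm_le_const (a := x) (b := 1)
    (f := (Set.Ico (0 : ℝ) 1).indicator ψ) (C := M) fun y _ => by
      by_cases hy : y ∈ Set.Ico (0 : ℝ) 1
      · rw [Set.indicator_of_mem hy]
        exact h.norm_le he hy
      · rw [Set.indicator_of_notMem hy, norm_zero]
        exact hM0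
  rw [abs_of_nonneg (by linarith [hx.2])] at h2
  exact h2.trans (mul_le_of_le_one_right hM0 (by linarith [hx.1]))

lemma IsModulated.tailInt_nil (h : IsModulated q e [] M ψ)
    (hint : ∀ a b, IntervalIntegrable ψ volume a b) : IsModulated q e [] M (tailInt ψ) := by
  have hM0 : 0 ≤ M := (norm_nonneg _).trans (h.norm_le (by simp) (x := 0) (by simp))
  refine ⟨(Set.Ico (0 : ℝ) 1).indicator (tailInt ψ),
    (continuous_tailInt hint).measurable.indicator measurableSet_Ico, fun x => ?_, by simp,
    fun x hx => ?_⟩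
  · by_cases hx : x ∈ Set.Ico (0 : ℝ) 1
    · rw [Set.indicator_of_mem hx]
      exact h.norm_tailInt_le (by simp) hx
    · rw [Set.indicator_of_notMem hx, norm_zero]
      exact hM0
  · rw [Set.indicator_of_mem hx]
    simp [digitProd]

/-- The finest digit, at position `m + 1`, averages out over each cell of length `q^(-m)`, so that
taking the primitive removes the corresponding factor and gains a factor `q^(-m)`. -/
lemma IsModulated.tailInt_cons (hq : 0 < q) {m : ℕ} (hL : ∀ b ∈ L, b ≤ m)
    (he : IsDigitFactor q (e (m + 1))) (h : IsModulated q e ((m + 1) :: L) M ψ)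
    (hint : ∀ a b, IntervalIntegrable ψ volume a b) :
    (∀ c : ℕ, c < q ^ m →
      ∫ x in (c / (q ^ m : ℕ) : ℝ)..((c + 1) / (q ^ m : ℕ) : ℝ), ψ x = 0) ∧
    tailInt ψ 0 = 0 ∧ IsModulated q e L (M * ((q : ℝ) ^ m)⁻¹) (tailInt ψ) := by
  obtain ⟨B, hBmeas, hM, hper, hψ⟩ := h
  have hq' : (0 : ℝ) < q := by exact_mod_cast hq
  set T : ℝ := ((q : ℝ) ^ m)⁻¹ with hT
  have hT0 : 0 < T := by positivity
  set F : ℝ → ℂ := fun x => e (m + 1) ⌊x * q ^ (m + 1)⌋ * B x with hF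
  have hFint : ∀ a b, IntervalIntegrable F volume a b :=
    intervalIntegrable_of_bounded (measurable_digit_mul _ hBmeas _) (norm_digit_mul_le he hM _)
  have hperB := hper (m + 1) (by simp)
  have hFper : Function.Periodic F T := periodic_digit_mul hq he hperB
  have hF0 : ∫ x in (0 : ℝ)..T, F x = 0 := integral_digit_mul_eq_zero hq he hBmeas hM hperB
  set P : ℝ → ℂ := fun x => ∫ y in (0 : ℝ)..x, F y with hP
  have hPper : Function.Periodic P T := periodic_primitive hFper hFint hF0
  have hPM : ∀ x, ‖P x‖ ≤ M * T := norm_primitive_le hT0 (norm_digit_mul_le he hM _) hPper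
  have hPnat : ∀ c : ℕ, P (c * T) = 0 := by
    intro c
    have := hPper.nat_mul c 0
    rw [zero_add] at this
    rw [this]
    simp [hP]
  -- On a cell of length `T` the digits in `L` are constant.
  have hpiece : ∀ c : ℕ, c < q ^ m → ∀ u v z : ℝ, c * T ≤ u → u ≤ v → v ≤ (c + 1) * T →
      c * T ≤ z → z < (c + 1) * T → ∫ x in u..v, ψ x = digitProd q e L z * (P v - P u) := by
    intro c hc u v z hu huv hv hz hz'
    have hcq : ((c : ℝ) + 1) * T ≤ 1 := by
      rw [hT, ← div_eq_mul_inv, div_le_one (by positivity)]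
      exact_mod_cast hc
    have hfloor : ∀ x : ℝ, c * T ≤ x → x < (c + 1) * T → ⌊x * q ^ m⌋ = (c : ℤ) := by
      intro x h1 h2
      rw [hT, ← div_eq_mul_inv, div_le_iff₀ (by positivity)] at h1
      rw [hT, ← div_eq_mul_inv, lt_div_iff₀ (by positivity)] at h2
      rw [Int.floor_eq_iff]
      exact ⟨by exact_mod_cast h1, by exact_mod_cast h2⟩
    have hcongr : ∫ x in u..v, ψ x = ∫ x in u..v, digitProd q e L z * F x := by
      refine intervalIntegral.integral_congr_Ioo_of_le huv fun x hx => ?_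
      have hx1 : c * T ≤ x := hu.trans hx.1.le
      have hx2 : x < (c + 1) * T := hx.2.trans_le hv
      have hx0 : 0 ≤ x := le_trans (by positivity) hx1
      have hsplit : digitProd q e ((m + 1) :: L) x =
          e (m + 1) ⌊x * q ^ (m + 1)⌋ * digitProd q e L x := by simp [digitProd]
      simp only [hF]
      rw [hψ x ⟨hx0, hx2.trans_le hcq⟩, hsplit,
        digitProd_congr hq e hL ((hfloor x hx1 hx2).trans (hfloor z hz hz').symm)]
      ring
    rw [hcongr, intervalIntegral.integral_const_mul]
    congr 1
    exact (intervalIntegral.integral_interval_sub_left (hFint 0 v) (hFint 0 u)).symm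
  have hcell : ∀ c : ℕ, c < q ^ m → ∫ x in (c * T)..((c + 1 : ℕ) * T), ψ x = 0 := by
    intro c hc
    rw [hpiece c hc _ _ (c * T) le_rfl (by push_cast; nlinarith) (by push_cast; rfl) le_rfl
      (by nlinarith), hPnat, hPnat, sub_zero, mul_zero]
  have htail : ∀ x ∈ Set.Ico (0 : ℝ) 1, tailInt ψ x = digitProd q e L x * -P x := by
    intro x hx
    set c : ℕ := ⌊x * q ^ m⌋₊ with hc
    have hx0 : 0 ≤ x * q ^ m := mul_nonneg hx.1 (by positivity)
    have h1 : c * T ≤ x := by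
      rw [hT, ← div_eq_mul_inv, div_le_iff₀ (by positivity)]
      exact Nat.floor_le hx0
    have h2 : x < (c + 1) * T := by
      rw [hT, ← div_eq_mul_inv, lt_div_iff₀ (by positivity)]
      exact Nat.lt_floor_add_one _
    have hcq : c < q ^ m := by
      rw [hc, Nat.floor_lt hx0]
      push_cast
      exact mul_lt_of_lt_one_left (by positivity) hx.2
    have hsum := intervalIntegral.sum_integral_adjacent_intervals_Ico (f := ψ) (μ := volume)
      (a := fun k : ℕ => (k : ℝ) * T) (m := c + 1) (n := q ^ m) hcq fun k _ => hint _ _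
    rw [Finset.sum_eq_zero fun k hk => hcell k (Finset.mem_Ico.1 hk).2] at hsum
    have hone : ((q ^ m : ℕ) : ℝ) * T = 1 := by
      rw [hT]; push_cast
      exact mul_inv_cancel₀ (by positivity)
    rw [hone] at hsum
    rw [tailInt, ← intervalIntegral.integral_add_adjacent_intervals
      (hint x ((c + 1 : ℕ) * T)) (hint _ 1), ← hsum, add_zero,
      hpiece c hcq _ _ x h1 (by push_cast; exact h2.le) (by push_cast; rfl) h1 h2, hPnat, zero_sub]
  refine ⟨fun c hc => ?_, ?_, fun x => -P x,
    (intervalIntegral.continuous_primitive hFint 0).measurable.neg,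
    fun x => by simpa using hPM x, fun b hb => ?_, htail⟩
  · have := hcell c hc
    rw [hT] at this
    push_cast at this ⊢
    simpa only [div_eq_mul_inv] using this
  · rw [htail 0 (by simp)]
    simp [hP]
  · -- The period `q^(-m)` of the primitive divides `q^(-b)`.
    have hb' : ((q : ℝ) ^ b)⁻¹ = ((q ^ (m - b) : ℕ) : ℝ) * T := by
      rw [hT]
      push_cast
      rw [← div_eq_mul_inv, eq_div_iff (by positivity), inv_mul_eq_iff_eq_mul₀ (by positivity),
        ← pow_add, Nat.add_sub_cancel' (hL b hb)]
    rw [hb']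
    have hneg : Function.Periodic (fun x => -P x) T := fun x => congrArg Neg.neg (hPper x)
    exact hneg.nat_mul _

end Modulated

/-- Every primitive removes the factor of the finest remaining digit. -/
lemma isModulated_tailInt_iterate {q : ℕ} (hq : 0 < q) {e : ℕ → ℤ → ℂ} (i : ℕ) :
    ∀ {L : List ℕ} {M : ℝ} {ψ : ℝ → ℂ}, L.Pairwise (· > ·) → (∀ a ∈ L, 0 < a) →
      (∀ a ∈ L, IsDigitFactor q (e a)) → IsModulated q e L M ψ →
      (∀ a b, IntervalIntegrable ψ volume a b) →
      IsModulated q e (L.drop i) (M * ((L.take i).map fun a => ((q : ℝ) ^ (a - 1))⁻¹).prod)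
        (tailInt^[i] ψ) := by
  induction i with
  | zero =>
    intro L M ψ _ _ _ h _
    simpa using h
  | succ i ih =>
    intro L M ψ hL hpos he h hint
    have hint' : ∀ a b, IntervalIntegrable (tailInt ψ) volume a b :=
      fun a b => (continuous_tailInt hint).intervalIntegrable a b
    rw [Function.iterate_succ_apply]
    cases L with
    | nil => simpa using ih List.Pairwise.nil (by simp) (by simp) (h.tailInt_nil hint) hint'
    | cons a L =>
      obtain ⟨m, rfl⟩ : ∃ m, a = m + 1 := ⟨a - 1, by have := hpos a (by simp); omega⟩
      rw [List.pairwise_cons] at hL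
      have h1 := (h.tailInt_cons hq (fun b hb => Nat.lt_succ_iff.1 (hL.1 b hb))
        (he _ (by simp)) hint).2.2
      have h2 := ih hL.2 (fun a ha => hpos a (by simp [ha])) (fun a ha => he a (by simp [ha]))
        h1 hint'
      simpa [mul_assoc] using h2

/-! ### Taylor kernels integrated against products of digit functions -/

lemma prod_map_inv_pow_le {q : ℕ} (hq : 0 < q) {δ : ℕ} {L : List ℕ} (hpos : ∀ a ∈ L, 0 < a)
    (hlen : L.length ≤ δ) :
    (L.map fun a => ((q : ℝ) ^ (a - 1))⁻¹).prod ≤ (q : ℝ) ^ δ * (q : ℝ) ^ (-(L.sum : ℝ)) := by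
  have hq' : (0 : ℝ) < q := by exact_mod_cast hq
  have h1 : (L.map fun a => ((q : ℝ) ^ (a - 1))⁻¹).prod =
      (q : ℝ) ^ L.length * (q : ℝ) ^ (-(L.sum : ℝ)) := by
    clear hlen
    induction L with
    | nil => simp
    | cons a L ih =>
      obtain ⟨m, rfl⟩ : ∃ m, a = m + 1 := ⟨a - 1, by have := hpos a (by simp); omega⟩
      rw [List.map_cons, List.prod_cons, ih fun b hb => hpos b (by simp [hb])]
      simp only [List.length_cons, List.sum_cons, Nat.add_sub_cancel]
      push_cast
      rw [neg_add, Real.rpow_add hq', Real.rpow_neg hq'.le ((m : ℝ) + 1),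
        show ((m : ℝ) + 1) = ((m + 1 : ℕ) : ℝ) by push_cast; rfl, Real.rpow_natCast]
      field_simp
      ring
  rw [h1]
  have hq1 : (1 : ℝ) ≤ q := by exact_mod_cast hq
  gcongr

section Axis

variable {q : ℕ} {e : ℕ → ℤ → ℂ} {L : List ℕ}

lemma isModulated_digitProd (q : ℕ) (e : ℕ → ℤ → ℂ) (L : List ℕ) :
    IsModulated q e L 1 (digitProd q e L) :=
  ⟨fun _ => 1, measurable_const, by simp, fun _ _ _ => rfl, by simp⟩

lemma integral_taylorKernel_mul_of_ne {δ i : ℕ} (hi : i ≠ δ) {W : ℝ → ℂ}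
    (hW : ∀ a b, IntervalIntegrable W volume a b) (t : ℝ) :
    ∫ x in Set.Ico (0 : ℝ) 1, (taylorKernel δ i x t : ℂ) * W x = tailInt^[i + 1] W 0 := by
  rw [tailInt_iterate_eq hW i zero_le_one, intervalIntegral.integral_of_le zero_le_one,
    integral_Ioc_eq_integral_Ioo, integral_Ico_eq_integral_Ioo]
  simp [taylorKernel, hi]

lemma integral_taylorKernel_mul_self {δ : ℕ} (hδ : 1 ≤ δ) {W : ℝ → ℂ}
    (hW : ∀ a b, IntervalIntegrable W volume a b) {t : ℝ} (ht : t ∈ Set.Ico (0 : ℝ) 1) :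
    ∫ x in Set.Ico (0 : ℝ) 1, (taylorKernel δ δ x t : ℂ) * W x = tailInt^[δ] W t := by
  obtain ⟨m, rfl⟩ : ∃ m, δ = m + 1 := ⟨δ - 1, by omega⟩
  rw [tailInt_iterate_eq hW m ht.2.le, intervalIntegral.integral_of_le ht.2.le,
    integral_Ioc_eq_integral_Ioo, ← integral_Ico_eq_integral_Ioo]
  have hI : Set.Ico t 1 = Set.Ico (0 : ℝ) 1 ∩ Set.Ici t := by
    ext x
    simp only [Set.mem_Ico, Set.mem_inter_iff, Set.mem_Ici]
    constructor
    · intro hx; exact ⟨⟨ht.1.trans hx.1, hx.2⟩, hx.1⟩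
    · intro hx; exact ⟨hx.2, hx.1.2⟩
  rw [hI, ← setIntegral_indicator measurableSet_Ici]
  refine integral_congr_ae (Filter.Eventually.of_forall fun x => ?_)
  by_cases hx : t ≤ x <;> simp [taylorKernel, ht.1, hx]

/-- A polynomial of degree `i < δ` is orthogonal to a product of more than `i` digit functions. -/
lemma norm_integral_taylorKernel_mul_le (hq : 0 < q) (hL : L.Pairwise (· > ·))
    (hpos : ∀ a ∈ L, 0 < a) (he : ∀ a ∈ L, IsDigitFactor q (e a)) {δ i : ℕ} (hi : i < δ)
    (lam t : ℝ) :
    ‖∫ x in Set.Ico (0 : ℝ) 1, (taylorKernel δ i x t : ℂ) * digitProd q e L x‖ ≤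
      (q : ℝ) ^ δ * (q : ℝ) ^ (-(((L.take δ).sum : ℝ) + lam * (L.getD δ 0 : ℝ))) := by
  have hint := intervalIntegrable_of_bounded (measurable_digitProd q e L) (norm_digitProd_le he)
  rw [integral_taylorKernel_mul_of_ne hi.ne hint, Function.iterate_succ_apply']
  have hmod := isModulated_tailInt_iterate hq i hL hpos he (isModulated_digitProd q e L) hint
  rcases lt_or_ge i L.length with hlt | hge
  · rw [List.drop_eq_getElem_cons hlt] at hmod
    have hmem : L[i] ∈ L := List.getElem_mem hlt
    obtain ⟨m, hm⟩ : ∃ m, L[i] = m + 1 := ⟨L[i] - 1, by have := hpos _ hmem; omega⟩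
    have hpw := hL.drop (i := i)
    rw [List.drop_eq_getElem_cons hlt, List.pairwise_cons] at hpw
    have hint' : ∀ a b, IntervalIntegrable (tailInt^[i] (digitProd q e L)) volume a b := by
      cases i with
      | zero => exact hint
      | succ i => exact fun a b => (continuous_tailInt_iterate hint i).intervalIntegrable a b
    rw [hm] at hmod hpw hmem
    rw [(hmod.tailInt_cons hq (fun b hb => Nat.lt_succ_iff.1 (hpw.1 b hb)) (he _ hmem)
      hint').2.1, norm_zero]
    positivity
  · rw [List.drop_eq_nil_of_le hge] at hmod
    have h0 : L.getD δ 0 = 0 := List.getD_eq_default _ _ (by omega)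
    rw [h0, List.take_of_length_le (by omega : L.length ≤ δ)]
    refine (hmod.norm_tailInt_le (by simp) (by simp)).trans ?_
    rw [one_mul, List.take_of_length_le hge]
    simpa using prod_map_inv_pow_le hq hpos (by omega : L.length ≤ δ)

/-- The remainder kernel integrated against a product of digit functions: the `δ` finest digits
determine the size and the next digit the scale `1 / n` of oscillation of the result. -/
lemma exists_integral_taylorKernel_mul_eq (hq : 0 < q) (hL : L.Pairwise (· > ·))
    (hpos : ∀ a ∈ L, 0 < a) (he : ∀ a ∈ L, IsDigitFactor q (e a)) {δ : ℕ} (hδ : 1 ≤ δ)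
    {lam : ℝ} (hlam1 : lam ≤ 1) :
    ∃ (η : ℝ → ℂ) (n : ℕ) (M : ℝ), 0 < n ∧ Measurable η ∧ (∀ x, ‖η x‖ ≤ M) ∧
      (∀ t ∈ Set.Ico (0 : ℝ) 1,
        ∫ x in Set.Ico (0 : ℝ) 1, (taylorKernel δ δ x t : ℂ) * digitProd q e L x = η t) ∧
      (n = 1 ∨ ∀ c : ℕ, c < n → ∫ x in (c / n : ℝ)..((c + 1) / n : ℝ), η x = 0) ∧
      M * (1 / n : ℝ) ^ lam ≤
        (q : ℝ) ^ (δ + 1) * (q : ℝ) ^ (-(((L.take δ).sum : ℝ) + lam * (L.getD δ 0 : ℝ))) := by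
  have hq' : (0 : ℝ) < q := by exact_mod_cast hq
  have hq1 : (1 : ℝ) ≤ q := by exact_mod_cast hq
  have hint := intervalIntegrable_of_bounded (measurable_digitProd q e L) (norm_digitProd_le he)
  have hmod := isModulated_tailInt_iterate hq δ hL hpos he (isModulated_digitProd q e L) hint
  set χ := tailInt^[δ] (digitProd q e L) with hχ
  set M := 1 * ((L.take δ).map fun a => ((q : ℝ) ^ (a - 1))⁻¹).prod with hM
  have hcont : Continuous χ := by
    obtain ⟨m, rfl⟩ : ∃ m, δ = m + 1 := ⟨δ - 1, by omega⟩
    exact continuous_tailInt_iterate hint m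
  have hMle : M ≤ (q : ℝ) ^ δ * (q : ℝ) ^ (-((L.take δ).sum : ℝ)) := by
    rw [hM, one_mul]
    exact prod_map_inv_pow_le hq (fun a ha => hpos a (List.mem_of_mem_take ha)) (by simp)
  have hχM : ∀ x ∈ Set.Ico (0 : ℝ) 1, ‖χ x‖ ≤ M := fun x hx =>
    hmod.norm_le (fun a ha => he a (List.mem_of_mem_drop ha)) hx
  have hM0 : 0 ≤ M := (norm_nonneg _).trans (hχM 0 (by simp))
  have hbound : ∀ x, ‖(Set.Ico (0 : ℝ) 1).indicator χ x‖ ≤ M := by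
    intro x
    by_cases hx : x ∈ Set.Ico (0 : ℝ) 1
    · rw [Set.indicator_of_mem hx]
      exact hχM x hx
    · rw [Set.indicator_of_notMem hx, norm_zero]
      exact hM0
  have heq : ∀ t ∈ Set.Ico (0 : ℝ) 1,
      ∫ x in Set.Ico (0 : ℝ) 1, (taylorKernel δ δ x t : ℂ) * digitProd q e L x =
        (Set.Ico (0 : ℝ) 1).indicator χ t := fun t ht => by
    rw [Set.indicator_of_mem ht, integral_taylorKernel_mul_self hδ hint ht]
  rcases lt_or_ge δ L.length with hlt | hge
  · rw [List.drop_eq_getElem_cons hlt] at hmod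
    have hmem : L[δ] ∈ L := List.getElem_mem hlt
    obtain ⟨m, hm⟩ : ∃ m, L[δ] = m + 1 := ⟨L[δ] - 1, by have := hpos _ hmem; omega⟩
    have hpw := hL.drop (i := δ)
    rw [List.drop_eq_getElem_cons hlt, List.pairwise_cons] at hpw
    have hget : L.getD δ 0 = m + 1 := by rw [List.getD_eq_getElem _ _ hlt, hm]
    rw [hm] at hmod hpw hmem
    have hcell := (hmod.tailInt_cons hq (fun b hb => Nat.lt_succ_iff.1 (hpw.1 b hb)) (he _ hmem)
      fun a b => hcont.intervalIntegrable a b).1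
    have hn0 : (0 : ℝ) < (q ^ m : ℕ) := by positivity
    refine ⟨(Set.Ico (0 : ℝ) 1).indicator χ, q ^ m, M, pow_pos hq m,
      hcont.measurable.indicator measurableSet_Ico, hbound, heq, Or.inr fun c hc => ?_, ?_⟩
    · rw [← hcell c hc]
      refine intervalIntegral.integral_congr_Ioo_of_le (by gcongr; linarith) fun x hx => ?_
      have hx0 : 0 ≤ x := le_trans (by positivity) hx.1.le
      refine Set.indicator_of_mem (show x ∈ Set.Ico (0 : ℝ) 1 from ⟨hx0, hx.2.trans_le ?_⟩) _
      rw [div_le_one hn0]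
      exact_mod_cast hc
    · -- `(1 / q^m) ^ lam` falls short of `q^(-lam (m+1))` by the factor `q^lam ≤ q`.
      rw [hget]
      have h1 : (1 / ((q ^ m : ℕ) : ℝ)) ^ lam = (q : ℝ) ^ (-(lam * m)) := by
        push_cast
        rw [one_div, Real.inv_rpow (by positivity), ← Real.rpow_natCast, ← Real.rpow_mul hq'.le,
          Real.rpow_neg hq'.le, mul_comm]
      have h2 : (q : ℝ) ^ (-(((L.take δ).sum : ℝ) + lam * ((m + 1 : ℕ) : ℝ))) =
          (q : ℝ) ^ (-((L.take δ).sum : ℝ)) * ((q : ℝ) ^ (-(lam * m)) * (q : ℝ) ^ (-lam)) := by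
        rw [← Real.rpow_add hq', ← Real.rpow_add hq']
        congr 1
        push_cast
        ring
      have h3 : (1 : ℝ) ≤ q * (q : ℝ) ^ (-lam) := by
        rw [Real.rpow_neg hq'.le, ← div_eq_mul_inv, one_le_div (by positivity)]
        simpa using Real.rpow_le_rpow_of_exponent_le hq1 hlam1
      rw [h1, h2]
      calc M * (q : ℝ) ^ (-(lam * m))
          ≤ ((q : ℝ) ^ δ * (q : ℝ) ^ (-((L.take δ).sum : ℝ))) * (q : ℝ) ^ (-(lam * m)) := by
            gcongr
        _ ≤ ((q : ℝ) ^ δ * (q : ℝ) ^ (-((L.take δ).sum : ℝ))) * (q : ℝ) ^ (-(lam * m)) *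
            (q * (q : ℝ) ^ (-lam)) := le_mul_of_one_le_right (by positivity) h3
        _ = _ := by ring
  · have h0 : L.getD δ 0 = 0 := List.getD_eq_default _ _ hge
    refine ⟨(Set.Ico (0 : ℝ) 1).indicator χ, 1, M, one_pos,
      hcont.measurable.indicator measurableSet_Ico, hbound, heq, Or.inl rfl, ?_⟩
    rw [h0]
    simp only [Nat.cast_one, div_one, Real.one_rpow, mul_one, Nat.cast_zero, mul_zero, add_zero]
    refine hMle.trans ?_
    gcongr
    omega

end Axis

/-! ### Walsh functions as products of digit functions -/

section Walsh

lemma mem_digitPositions {q k a : ℕ} :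
    a ∈ digitPositions q k ↔ ∃ l < (Nat.digits q k).length, k / q ^ l % q ≠ 0 ∧ l + 1 = a := by
  simp [digitPositions, and_assoc]

lemma digitPositions_pairwise (q k : ℕ) : (digitPositions q k).Pairwise (· > ·) := by
  unfold digitPositions
  exact (Finset.sortedGT_sort _).pairwise

variable {p : ℕ} {F : Type*} [Field F] [Algebra (ZMod p) F]

/-- The factor `exp(2πi/p ∑ᵢ ηᵢ(κ) ηᵢ(ξ))` of a Walsh function belonging to a digit `κ` of the index
and a digit `ξ` of the argument. -/
noncomputable def digitChar (pb : PowerBasis (ZMod p) F) {q : ℕ} (φ : Fin q → F) (κ ξ : Fin q) :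
    ℂ :=
  Complex.exp (2 * Real.pi * Complex.I / p * ∑ i : Fin pb.dim,
    (((pb.basis.repr (φ κ) i).val : ℂ) * ((pb.basis.repr (φ ξ) i).val : ℂ)))

/-- The additive character `b ↦ exp(2πi/p ∑ᵢ aᵢ bᵢ)`. -/
noncomputable def dotChar [NeZero p] {d : ℕ} (a : Fin d → ZMod p) : AddChar (Fin d → ZMod p) ℂ :=
  ZMod.stdAddChar.compAddMonoidHom
    (∑ i, (AddMonoidHom.mulLeft (a i)).comp (Pi.evalAddMonoidHom (fun _ : Fin d => ZMod p) i))

lemma dotChar_apply [NeZero p] {d : ℕ} (a b : Fin d → ZMod p) :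
    dotChar a b = ZMod.stdAddChar (∑ i, a i * b i) := by
  simp [dotChar]

lemma dotChar_ne_one [NeZero p] {d : ℕ} {a : Fin d → ZMod p} (ha : a ≠ 0) : dotChar a ≠ 1 := by
  obtain ⟨i, hi⟩ := Function.ne_iff.1 ha
  intro h
  have h1 := DFunLike.congr_fun h (Pi.single i 1)
  rw [dotChar_apply, Finset.sum_eq_single i (fun j _ hj => by simp [hj]) (by simp)] at h1
  simp only [Pi.single_eq_same, mul_one, AddChar.one_apply] at h1
  exact hi (ZMod.injective_stdAddChar (h1.trans (AddChar.map_zero_eq_one _).symm))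

lemma digitChar_eq_dotChar [NeZero p] (pb : PowerBasis (ZMod p) F) {q : ℕ} (φ : Fin q → F)
    (κ ξ : Fin q) :
    digitChar pb φ κ ξ = dotChar (pb.basis.equivFun (φ κ)) (pb.basis.equivFun (φ ξ)) := by
  have hcast : ∑ i, pb.basis.equivFun (φ κ) i * pb.basis.equivFun (φ ξ) i =
      ((∑ i, ((pb.basis.repr (φ κ) i).val * (pb.basis.repr (φ ξ) i).val : ℤ) : ℤ) : ZMod p) := by
    push_cast
    simp
  rw [dotChar_apply, hcast, ZMod.stdAddChar_coe]
  unfold digitChar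
  push_cast
  congr 1
  ring

lemma norm_digitChar [NeZero p] (pb : PowerBasis (ZMod p) F) {q : ℕ} (φ : Fin q → F)
    (κ ξ : Fin q) : ‖digitChar pb φ κ ξ‖ = 1 := by
  rw [digitChar_eq_dotChar]
  exact AddChar.norm_apply _ _

lemma digitChar_zero (pb : PowerBasis (ZMod p) F) {q : ℕ} [NeZero q] {φ : Fin q → F}
    (h0 : φ 0 = 0) (ξ : Fin q) : digitChar pb φ 0 ξ = 1 := by
  simp [digitChar, h0]

lemma sum_digitChar [NeZero p] (pb : PowerBasis (ZMod p) F) {q : ℕ} [NeZero q] {φ : Fin q → F}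
    (hφ : Function.Bijective φ) (h0 : φ 0 = 0) {κ : Fin q} (hκ : κ ≠ 0) :
    ∑ ξ, digitChar pb φ κ ξ = 0 := by
  have ha : pb.basis.equivFun (φ κ) ≠ 0 := by
    intro h
    exact hκ (hφ.1 (by rw [h0]; exact pb.basis.equivFun.map_eq_zero_iff.1 h))
  simp_rw [digitChar_eq_dotChar]
  have hbij : Function.Bijective fun ξ => pb.basis.equivFun (φ ξ) :=
    pb.basis.equivFun.bijective.comp hφ
  rw [hbij.sum_comp (dotChar (pb.basis.equivFun (φ κ)))]
  exact AddChar.sum_eq_zero_of_ne_one (dotChar_ne_one ha)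

variable {q : ℕ} [NeZero q]

/-- The conjugate of the factor of `wal_k` belonging to the `a`-th digit of the argument, as a
`q`-periodic function on the integers. -/
noncomputable def walFactor (pb : PowerBasis (ZMod p) F) (φ : Fin q → F) (k a : ℕ) (c : ℤ) : ℂ :=
  (starRingEnd ℂ) (digitChar pb φ (natDigit q k (a - 1)) (Fin.ofNat q (c % q).toNat))

lemma natDigit_eq_zero_iff (k l : ℕ) : natDigit q k l = 0 ↔ k / q ^ l % q = 0 := by
  rw [← Fin.val_eq_zero_iff]
  rfl

lemma isDigitFactor_walFactor [NeZero p] (pb : PowerBasis (ZMod p) F) {φ : Fin q → F}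
    (hφ : Function.Bijective φ) (h0 : φ 0 = 0) {k a : ℕ} (ha : a ∈ digitPositions q k) :
    IsDigitFactor q (walFactor pb φ k a) where
  add_base c := by simp [walFactor]
  sum_eq_zero := by
    obtain ⟨l, -, hl, rfl⟩ := mem_digitPositions.1 ha
    have hne : natDigit q k l ≠ 0 := fun h => hl ((natDigit_eq_zero_iff k l).1 h)
    have h := congrArg (starRingEnd ℂ) (sum_digitChar pb hφ h0 hne)
    rw [map_sum, map_zero] at h
    rw [← h, Finset.sum_range]
    refine Finset.sum_congr rfl fun ξ _ => ?_
    unfold walFactor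
    congr 2
    ext
    have : ((ξ : ℕ) : ℤ) % (q : ℤ) = ((ξ : ℕ) : ℤ) := by
      exact_mod_cast Nat.mod_eq_of_lt ξ.2
    rw [this]
    simp [Fin.ofNat, Nat.mod_eq_of_lt ξ.2]
  norm_le_one c := by
    unfold walFactor
    rw [RCLike.norm_conj, norm_digitChar]

lemma wal_eq_prod [NeZero p] (pb : PowerBasis (ZMod p) F) (φ : Fin q → F) (k : ℕ) (x : ℝ) :
    wal pb φ k x = ∏ l ∈ Finset.range (Nat.digits q k).length,
      digitChar pb φ (natDigit q k l) (Real.digits x q l) := by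
  unfold wal digitChar
  rw [Finset.mul_sum, Complex.exp_sum]

lemma conj_wal_eq_digitProd [NeZero p] (pb : PowerBasis (ZMod p) F) {φ : Fin q → F}
    (h0 : φ 0 = 0) (k : ℕ) {x : ℝ} (hx : 0 ≤ x) :
    (starRingEnd ℂ) (wal pb φ k x) =
      digitProd q (walFactor pb φ k) (digitPositions q k) x := by
  have hnodup : (digitPositions q k).Nodup := Finset.sort_nodup _ _
  have htoFin : (digitPositions q k).toFinset =
      ((Finset.range (Nat.digits q k).length).filter fun l => k / q ^ l % q ≠ 0).image
        (· + 1) := Finset.sort_toFinset _ _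
  unfold digitProd
  rw [← List.prod_toFinset _ hnodup, htoFin, Finset.prod_image fun a _ b _ h => by simpa using h,
    Finset.prod_filter, wal_eq_prod, map_prod]
  refine Finset.prod_congr rfl fun l _ => ?_
  split_ifs with h
  · unfold walFactor Real.digits
    congr 2
    have hnn : 0 ≤ x * (q : ℝ) ^ (l + 1) := by positivity
    ext
    rw [← Int.natCast_floor_eq_floor hnn]
    simp only [Fin.ofNat]
    rw [← Int.natCast_mod, Int.toNat_natCast, Nat.mod_mod]
  · rw [(natDigit_eq_zero_iff k l).2 (not_not.1 h), digitChar_zero pb h0, map_one]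

end Walsh

/-! ### Anchored functions -/

/-- Extension of a point by zero in the coordinates `j` with `τ j ≠ δ`. -/
noncomputable def anchorPoint {s : ℕ} (δ : ℕ) (τ : Fin s → ℕ) (y : {j // j ∈ topSet δ τ} → ℝ) :
    Fin s → ℝ := fun j => if h : j ∈ topSet δ τ then y ⟨j, h⟩ else 0

lemma mem_topSet {s : ℕ} {δ : ℕ} {τ : Fin s → ℕ} {j : Fin s} : j ∈ topSet δ τ ↔ τ j = δ := by
  simp [topSet]

lemma anchorPoint_coe {s : ℕ} {δ : ℕ} {τ : Fin s → ℕ} (y : {j // j ∈ topSet δ τ} → ℝ)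
    (j : {j // j ∈ topSet δ τ}) : anchorPoint δ τ y j = y j := by
  simp [anchorPoint]

lemma anchorPoint_of_notMem {s : ℕ} {δ : ℕ} {τ : Fin s → ℕ} (y : {j // j ∈ topSet δ τ} → ℝ)
    {j : Fin s} (hj : j ∉ topSet δ τ) : anchorPoint δ τ y j = 0 := by
  simp [anchorPoint, hj]

lemma measurable_anchorPoint {s : ℕ} (δ : ℕ) (τ : Fin s → ℕ) : Measurable (anchorPoint δ τ) := by
  refine measurable_pi_lambda _ fun j => ?_
  by_cases h : j ∈ topSet δ τ
  · simpa [anchorPoint, h] using measurable_pi_apply _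
  · simp [anchorPoint, h]

lemma measurableEmbedding_anchorPoint {s : ℕ} (δ : ℕ) (τ : Fin s → ℕ) :
    MeasurableEmbedding (anchorPoint δ τ) := by
  refine (measurable_anchorPoint δ τ).measurableEmbedding fun y y' h => ?_
  funext j
  rw [← anchorPoint_coe y j, h, anchorPoint_coe]

lemma prod_topSet_mul_prod {s : ℕ} {R : Type*} [CommMonoid R] (δ : ℕ) (τ : Fin s → ℕ)
    (a : Fin s → R) :
    ∏ j, a j = (∏ j : {j // j ∈ topSet δ τ}, a j) * ∏ j : {j // j ∉ topSet δ τ}, a j := by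
  convert (Fintype.prod_subtype_mul_prod_subtype (· ∈ topSet δ τ) a).symm

lemma measurePreserving_anchorPoint {s : ℕ} (δ : ℕ) (τ : Fin s → ℕ) :
    MeasurePreserving (anchorPoint δ τ)
      (volume.restrict (unitCube {j // j ∈ topSet δ τ}))
      (Measure.pi fun j => axisMeasure δ (τ j)) := by
  refine ⟨measurable_anchorPoint δ τ, (Measure.pi_eq fun S hS => ?_).symm⟩
  rw [Measure.map_apply (measurable_anchorPoint δ τ) (MeasurableSet.univ_pi hS), restrict_unitCube,
    prod_topSet_mul_prod δ τ]
  by_cases hall : ∀ j, j ∉ topSet δ τ → (0 : ℝ) ∈ S j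
  · have hpre : anchorPoint δ τ ⁻¹' Set.univ.pi S =
        Set.univ.pi fun j : {j // j ∈ topSet δ τ} => S j := by
      ext y
      simp only [Set.mem_preimage, Set.mem_univ_pi]
      constructor
      · intro h j
        rw [← anchorPoint_coe y j]
        exact h j
      · intro h j
        by_cases hj : j ∈ topSet δ τ
        · simpa [anchorPoint, hj] using h ⟨j, hj⟩
        · rw [anchorPoint_of_notMem y hj]
          exact hall j hj
    rw [hpre, Measure.pi_pi, Finset.prod_eq_one (s := Finset.univ)
      (f := fun j : {j // j ∉ topSet δ τ} => axisMeasure δ (τ j) (S j)), mul_one]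
    · refine Finset.prod_congr rfl fun j _ => ?_
      rw [axisMeasure, if_pos (mem_topSet.1 j.2)]
    · intro j _
      rw [axisMeasure, if_neg fun h => j.2 (mem_topSet.2 h), Measure.dirac_apply' _ (hS _),
        Set.indicator_of_mem (hall j j.2), Pi.one_apply]
  · push Not at hall
    obtain ⟨j, hj, hj0⟩ := hall
    have hpre : anchorPoint δ τ ⁻¹' Set.univ.pi S = ∅ := by
      refine Set.eq_empty_of_forall_notMem fun y hy => hj0 ?_
      rw [← anchorPoint_of_notMem y hj]
      exact hy j (Set.mem_univ j)
    have hzero : ∏ j : {j // j ∉ topSet δ τ}, axisMeasure δ (τ j) (S j) = 0 := by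
      refine Finset.prod_eq_zero (Finset.mem_univ (⟨j, hj⟩ : {j // j ∉ topSet δ τ})) ?_
      rw [axisMeasure, if_neg fun h => hj (mem_topSet.2 h), Measure.dirac_apply' _ (hS _),
        Set.indicator_of_notMem hj0]
    rw [hpre, measure_empty, hzero, mul_zero]

lemma integrable_mixedDeriv_of_anchored {s : ℕ} {δ : ℕ} {f : (Fin s → ℝ) → ℝ} {τ : Fin s → ℕ}
    (h : IntegrableOn (anchored δ f τ) (unitCube _)) :
    Integrable (mixedDeriv f τ) (Measure.pi fun j => axisMeasure δ (τ j)) :=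
  ((measurePreserving_anchorPoint δ τ).integrable_comp_emb
    (measurableEmbedding_anchorPoint δ τ)).1 h

lemma integrableOn_of_hardyKrauseVar_lt_top {ι : Type*} [Fintype ι] {lam p q : ℝ}
    {g : (ι → ℝ) → ℝ} (h : hardyKrauseVar lam p q g < ∞) : IntegrableOn g (unitCube ι) := by
  by_contra hcon
  rw [hardyKrauseVar, if_neg hcon] at h
  exact lt_irrefl _ h

/-! ### Consequences of Taylor's formula -/

section Taylor

variable {s δ : ℕ} {f : (Fin s → ℝ) → ℝ}

lemma ae_restrict_unitCube (s : ℕ) : ∀ᵐ x ∂(volume : Measure (Fin s → ℝ)).restrict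
    (unitCube (Fin s)), x ∈ unitCube (Fin s) :=
  ae_restrict_mem (measurableSet_unitCube _)

instance (ι : Type*) [Fintype ι] :
    IsProbabilityMeasure ((volume : Measure (ι → ℝ)).restrict (unitCube ι)) :=
  ⟨by rw [Measure.restrict_apply_univ, volume_unitCube]⟩

lemma integrable_mixedDeriv_mul_taylorKernel {τ : Fin s → ℕ}
    (hint : Integrable (mixedDeriv f τ) (Measure.pi fun j => axisMeasure δ (τ j))) :
    Integrable (fun w : (Fin s → ℝ) × (Fin s → ℝ) =>
      mixedDeriv f τ w.2 * ∏ j, taylorKernel δ (τ j) (w.1 j) (w.2 j))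
      ((volume.restrict (unitCube (Fin s))).prod (Measure.pi fun j => axisMeasure δ (τ j))) := by
  refine (hint.comp_snd _).mul_bdd (c := 1) ?_ ?_
  · exact (Finset.measurable_prod _ fun j _ => measurable_taylorKernel δ (τ j)
      ((measurable_pi_apply j).comp measurable_fst)
      ((measurable_pi_apply j).comp measurable_snd)).aestronglyMeasurable
  · have h := Measure.quasiMeasurePreserving_fst
      (μ := (volume : Measure (Fin s → ℝ)).restrict (unitCube (Fin s)))
      (ν := Measure.pi fun j => axisMeasure δ (τ j))
    filter_upwards [h.ae (ae_restrict_unitCube s)] with w hw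
    exact norm_prod_taylorKernel_le δ τ hw _

/-- Taylor's formula shows that `f` is bounded and measurable on the cube. -/
lemma memLp_two_of_integrable_mixedDeriv (hδ : 1 ≤ δ) (hf : HasMixedDerivs δ f)
    (hint : ∀ τ ∈ Fintype.piFinset fun _ : Fin s => Finset.range (δ + 1),
      Integrable (mixedDeriv f τ) (Measure.pi fun j => axisMeasure δ (τ j))) :
    MemLp f 2 (volume.restrict (unitCube (Fin s))) := by
  have htaylor := eq_sum_integral_mixedDeriv hδ s f hf hint
  refine MemLp.of_bound (C := ∑ τ ∈ Fintype.piFinset fun _ : Fin s => Finset.range (δ + 1),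
    ∫ t, ‖mixedDeriv f τ t‖ ∂Measure.pi fun j => axisMeasure δ (τ j)) ?_ ?_
  · have hmeas : AEStronglyMeasurable (fun x : Fin s → ℝ =>
        ∑ τ ∈ Fintype.piFinset fun _ : Fin s => Finset.range (δ + 1),
          ∫ t, mixedDeriv f τ t * ∏ j, taylorKernel δ (τ j) (x j) (t j)
            ∂Measure.pi fun j => axisMeasure δ (τ j)) (volume.restrict (unitCube (Fin s))) :=
      Finset.aestronglyMeasurable_fun_sum _ fun τ hτ =>
        (integrable_mixedDeriv_mul_taylorKernel (hint τ hτ)).integral_prod_left.aestronglyMeasurable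
    refine hmeas.congr ?_
    filter_upwards [ae_restrict_unitCube s] with x hx
    exact (htaylor x hx).symm
  · filter_upwards [ae_restrict_unitCube s] with x hx
    rw [htaylor x hx]
    refine (norm_sum_le _ _).trans (Finset.sum_le_sum fun τ hτ => ?_)
    refine norm_integral_le_of_norm_le (hint τ hτ).norm (Filter.Eventually.of_forall fun t => ?_)
    rw [norm_mul]
    exact mul_le_of_le_one_right (norm_nonneg _) (norm_prod_taylorKernel_le δ τ hx t)

/-- Inserting Taylor's formula into an integral against a product of functions of one variable. -/
lemma setIntegral_mul_prod_eq_sum (hδ : 1 ≤ δ) (hf : HasMixedDerivs δ f)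
    (hint : ∀ τ ∈ Fintype.piFinset fun _ : Fin s => Finset.range (δ + 1),
      Integrable (mixedDeriv f τ) (Measure.pi fun j => axisMeasure δ (τ j)))
    {W : Fin s → ℝ → ℂ} (hW : ∀ j, Measurable (W j)) (hW1 : ∀ j x, ‖W j x‖ ≤ 1) :
    ∫ x in unitCube (Fin s), (f x : ℂ) * ∏ j, W j (x j) =
      ∑ τ ∈ Fintype.piFinset fun _ : Fin s => Finset.range (δ + 1),
        ∫ t, (mixedDeriv f τ t : ℂ) * (∏ j, ∫ x in Set.Ico (0 : ℝ) 1,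
          (taylorKernel δ (τ j) x (t j) : ℂ) * W j x)
          ∂Measure.pi fun j => axisMeasure δ (τ j) := by
  have htaylor := eq_sum_integral_mixedDeriv hδ s f hf hint
  have hprod : ∀ τ ∈ Fintype.piFinset fun _ : Fin s => Finset.range (δ + 1),
      Integrable (fun w : (Fin s → ℝ) × (Fin s → ℝ) =>
        ((mixedDeriv f τ w.2 * ∏ j, taylorKernel δ (τ j) (w.1 j) (w.2 j) : ℝ) : ℂ) *
          ∏ j, W j (w.1 j))
        ((volume.restrict (unitCube (Fin s))).prod
          (Measure.pi fun j => axisMeasure δ (τ j))) := by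
    intro τ hτ
    have h1 : Integrable (fun w : (Fin s → ℝ) × (Fin s → ℝ) =>
        ((mixedDeriv f τ w.2 * ∏ j, taylorKernel δ (τ j) (w.1 j) (w.2 j) : ℝ) : ℂ))
        ((volume.restrict (unitCube (Fin s))).prod
          (Measure.pi fun j => axisMeasure δ (τ j))) :=
      (integrable_mixedDeriv_mul_taylorKernel (hint τ hτ)).ofReal
    refine h1.mul_bdd (c := 1) ?_ (Filter.Eventually.of_forall fun w => ?_)
    · exact (Finset.measurable_prod _ fun j _ => (hW j).comp
        ((measurable_pi_apply j).comp measurable_fst)).aestronglyMeasurable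
    · rw [norm_prod]
      exact Finset.prod_le_one (fun _ _ => norm_nonneg _) fun j _ => hW1 j _
  have hx : ∀ x ∈ unitCube (Fin s), (f x : ℂ) * ∏ j, W j (x j) =
      ∑ τ ∈ Fintype.piFinset fun _ : Fin s => Finset.range (δ + 1),
        ∫ t, ((mixedDeriv f τ t * ∏ j, taylorKernel δ (τ j) (x j) (t j) : ℝ) : ℂ) *
          ∏ j, W j (x j) ∂Measure.pi fun j => axisMeasure δ (τ j) := by
    intro x hx
    conv_lhs => rw [htaylor x hx]
    push_cast
    rw [Finset.sum_mul]
    refine Finset.sum_congr rfl fun τ _ => ?_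
    rw [integral_mul_const, ← integral_complex_ofReal]
    push_cast
    rfl
  rw [setIntegral_congr_fun (measurableSet_unitCube _) hx,
    integral_finsetSum _ fun τ hτ => (hprod τ hτ).integral_prod_left]
  refine Finset.sum_congr rfl fun τ hτ => ?_
  rw [integral_integral_swap (hprod τ hτ)]
  refine integral_congr_ae (Filter.Eventually.of_forall fun t => ?_)
  simp only
  rw [restrict_unitCube, ← integral_fintype_prod_eq_prod (fun j x =>
    (taylorKernel δ (τ j) x (t j) : ℂ) * W j x), ← integral_const_mul]
  refine integral_congr_ae (Filter.Eventually.of_forall fun x => ?_)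
  simp only [Finset.prod_mul_distrib]
  push_cast
  ring

end Taylor

/-! ### The decay of the Walsh coefficients -/

/-- The contribution of one term `f^(τ)` of Taylor's formula to the Walsh coefficient. -/
lemma enorm_integral_mixedDeriv_mul_prod_le {s δ q : ℕ} (hq : 0 < q) (hδ : 1 ≤ δ)
    {lam P Q : ℝ} (hlam : 0 < lam) (hlam1 : lam ≤ 1) (hP : 1 ≤ P) (hQ : 1 ≤ Q)
    {f : (Fin s → ℝ) → ℝ} {τ : Fin s → ℕ} (hτ : ∀ j, τ j ≤ δ)
    (hint : IntegrableOn (anchored δ f τ) (unitCube _))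
    {e : Fin s → ℕ → ℤ → ℂ} {L : Fin s → List ℕ} (hL : ∀ j, (L j).Pairwise (· > ·))
    (hpos : ∀ j, ∀ a ∈ L j, 0 < a) (he : ∀ j, ∀ a ∈ L j, IsDigitFactor q (e j a)) :
    ‖∫ t, (mixedDeriv f τ t : ℂ) * (∏ j, ∫ x in Set.Ico (0 : ℝ) 1,
        (taylorKernel δ (τ j) x (t j) : ℂ) * digitProd q (e j) (L j) x)
        ∂Measure.pi fun j => axisMeasure δ (τ j)‖ₑ ≤
      ENNReal.ofReal (∏ j, 8 * ((q : ℝ) ^ (δ + 1) * (q : ℝ) ^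
        (-((((L j).take δ).sum : ℝ) + lam * ((L j).getD δ 0 : ℝ))))) *
        hardyKrauseVar lam P Q (anchored δ f τ) := by
  have hq1 : (1 : ℝ) ≤ q := by exact_mod_cast hq
  set b : Fin s → ℝ := fun j => (q : ℝ) ^ (δ + 1) * (q : ℝ) ^
    (-((((L j).take δ).sum : ℝ) + lam * ((L j).getD δ 0 : ℝ))) with hb
  have hb0 : ∀ j, 0 ≤ b j := fun j => by positivity
  choose η n M hn hηmeas hηM hηeq hηzero hηb using fun j =>
    exists_integral_taylorKernel_mul_eq hq (hL j) (hpos j) (he j) hδ hlam1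
  set c : Fin s → ℂ := fun j => ∫ x in Set.Ico (0 : ℝ) 1,
    (taylorKernel δ (τ j) x 0 : ℂ) * digitProd q (e j) (L j) x with hc
  have hcb : ∀ j : {j // j ∉ topSet δ τ}, ‖c j‖ ≤ 8 * b j := by
    intro j
    have hlt : τ j < δ := lt_of_le_of_ne (hτ j) fun h => j.2 (mem_topSet.2 h)
    refine (norm_integral_taylorKernel_mul_le hq (hL j) (hpos j) (he j) hlt lam 0).trans ?_
    refine le_trans ?_ (le_mul_of_one_le_left (hb0 j) (by norm_num))
    simp only [hb]
    gcongr
    omega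
  have hcube : ∀ y ∈ unitCube {j // j ∈ topSet δ τ},
      (mixedDeriv f τ (anchorPoint δ τ y) : ℂ) * ∏ j, ∫ x in Set.Ico (0 : ℝ) 1,
        (taylorKernel δ (τ j) x (anchorPoint δ τ y j) : ℂ) * digitProd q (e j) (L j) x =
      (∏ j : {j // j ∉ topSet δ τ}, c j) *
        ((anchored δ f τ y : ℂ) * ∏ j : {j // j ∈ topSet δ τ}, η j (y j)) := by
    intro y hy
    rw [prod_topSet_mul_prod δ τ]
    have h1 : ∏ j : {j // j ∈ topSet δ τ}, ∫ x in Set.Ico (0 : ℝ) 1,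
        (taylorKernel δ (τ j) x (anchorPoint δ τ y j) : ℂ) * digitProd q (e j) (L j) x =
        ∏ j : {j // j ∈ topSet δ τ}, η j (y j) := by
      refine Finset.prod_congr rfl fun j _ => ?_
      rw [anchorPoint_coe, mem_topSet.1 j.2]
      exact hηeq j _ (mem_unitCube.1 hy j)
    have h2 : ∏ j : {j // j ∉ topSet δ τ}, ∫ x in Set.Ico (0 : ℝ) 1,
        (taylorKernel δ (τ j) x (anchorPoint δ τ y j) : ℂ) * digitProd q (e j) (L j) x =
        ∏ j : {j // j ∉ topSet δ τ}, c j := by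
      refine Finset.prod_congr rfl fun j _ => ?_
      rw [anchorPoint_of_notMem y j.2]
    rw [h1, h2]
    have h3 : mixedDeriv f τ (anchorPoint δ τ y) = anchored δ f τ y := rfl
    rw [h3]
    ring
  rw [← (measurePreserving_anchorPoint δ τ).integral_comp (measurableEmbedding_anchorPoint δ τ),
    setIntegral_congr_fun (measurableSet_unitCube _) hcube, integral_const_mul, enorm_mul]
  refine (mul_le_mul_right (enorm_setIntegral_mul_prod_le_hardyKrauseVar hlam hP hQ hint
    (n := fun j => n j) (fun j => hn j) (χ := fun j => η j) (fun j => hηmeas j)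
    (M := fun j => M j) (fun j => hηM j) fun j => hηzero j) _).trans ?_
  rw [← mul_assoc, ← ofReal_norm, norm_prod, ← ENNReal.ofReal_mul
    (Finset.prod_nonneg fun _ _ => norm_nonneg _)]
  refine mul_le_mul_left (ENNReal.ofReal_le_ofReal ?_) _
  rw [prod_topSet_mul_prod δ τ, mul_comm]
  have hM0 : ∀ j, 0 ≤ M j := fun j => (norm_nonneg _).trans (hηM j 0)
  refine mul_le_mul (Finset.prod_le_prod (fun j _ => ?_) fun j _ => ?_)
    (Finset.prod_le_prod (fun _ _ => norm_nonneg _) fun j _ => hcb j)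
    (Finset.prod_nonneg fun _ _ => norm_nonneg _)
    (Finset.prod_nonneg fun j _ => mul_nonneg (by norm_num) (hb0 j))
  · have := hM0 j
    positivity
  · exact mul_le_mul_of_nonneg_left (hηb j) (by norm_num)

lemma hardyKrauseVar_le_N {s δ : ℕ} {lam P Q R : ℝ} (hR : 1 ≤ R) {γ : Finset (Fin s) → ℝ≥0}
    {f : (Fin s → ℝ) → ℝ} (hN : N δ lam P Q R γ f < ∞) {τ : Fin s → ℕ}
    (hτ : τ ∈ Fintype.piFinset fun _ : Fin s => Finset.range (δ + 1)) :
    hardyKrauseVar lam P Q (anchored δ f τ) ≤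
      ENNReal.ofReal (1 + ∑ v, (γ v : ℝ)) * N δ lam P Q R γ f := by
  have hR0 : 0 < R := by linarith
  set V := hardyKrauseVar lam P Q (anchored δ f τ) with hV
  set A := N δ lam P Q R γ f with hA
  set g : ℝ≥0 := γ (posSet τ) with hg
  have hterm : (g : ℝ≥0∞)⁻¹ * V ^ R ≤ A ^ R := by
    rw [hA, N, ← ENNReal.rpow_mul, one_div_mul_cancel hR0.ne', ENNReal.rpow_one]
    exact Finset.single_le_sum (f := fun τ => (γ (posSet τ) : ℝ≥0∞)⁻¹ *
      hardyKrauseVar lam P Q (anchored δ f τ) ^ R) (fun _ _ => zero_le) hτ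
  have hAR : A ^ R < ∞ := ENNReal.rpow_lt_top_of_nonneg hR0.le hN.ne
  have hVR : V ^ R ≤ g * A ^ R := by
    rcases eq_or_ne g 0 with h0 | h0
    · -- For `γ = 0` the finiteness of `N` forces the variation to vanish.
      rw [h0] at hterm ⊢
      by_cases hV0 : V ^ R = 0
      · rw [hV0]
        exact zero_le
      · rw [ENNReal.coe_zero, ENNReal.inv_zero, ENNReal.top_mul hV0] at hterm
        exact absurd hAR (not_lt.2 hterm)
    · rwa [ENNReal.inv_mul_le_iff (by exact_mod_cast h0) ENNReal.coe_ne_top] at hterm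
  have hg1 : (g : ℝ≥0∞) ^ (1 / R) ≤ ENNReal.ofReal (1 + ∑ v, (γ v : ℝ)) := by
    have h1 : (g : ℝ) ≤ 1 + ∑ v, (γ v : ℝ) := by
      have := Finset.single_le_sum (f := fun v => (γ v : ℝ)) (fun v _ => (γ v).2)
        (Finset.mem_univ (posSet τ))
      linarith
    have h2 : (1 : ℝ) ≤ 1 + ∑ v, (γ v : ℝ) := by
      have : 0 ≤ ∑ v, (γ v : ℝ) := Finset.sum_nonneg fun v _ => (γ v).2
      linarith
    calc (g : ℝ≥0∞) ^ (1 / R)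
        ≤ ENNReal.ofReal (1 + ∑ v, (γ v : ℝ)) ^ (1 / R) := by
          refine ENNReal.rpow_le_rpow ?_ (by positivity)
          rw [← ENNReal.ofReal_coe_nnreal]
          exact ENNReal.ofReal_le_ofReal h1
      _ ≤ ENNReal.ofReal (1 + ∑ v, (γ v : ℝ)) ^ (1 : ℝ) := by
          refine ENNReal.rpow_le_rpow_of_exponent_le ?_ ?_
          · rw [← ENNReal.ofReal_one]
            exact ENNReal.ofReal_le_ofReal h2
          · rw [div_le_one hR0]
            exact hR
      _ = _ := ENNReal.rpow_one _
  calc V = (V ^ R) ^ (1 / R) := by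
        rw [← ENNReal.rpow_mul, mul_one_div_cancel hR0.ne', ENNReal.rpow_one]
    _ ≤ (g * A ^ R) ^ (1 / R) := ENNReal.rpow_le_rpow hVR (by positivity)
    _ = (g : ℝ≥0∞) ^ (1 / R) * A := by
        rw [ENNReal.mul_rpow_of_nonneg _ _ (by positivity), ← ENNReal.rpow_mul,
          mul_one_div_cancel hR0.ne', ENNReal.rpow_one]
    _ ≤ _ := mul_le_mul_left hg1 _

lemma integrableOn_anchored_of_N_lt_top {s δ : ℕ} {lam P Q R : ℝ} (hR : 1 ≤ R)
    {γ : Finset (Fin s) → ℝ≥0} {f : (Fin s → ℝ) → ℝ} (hN : N δ lam P Q R γ f < ∞)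
    {τ : Fin s → ℕ} (hτ : τ ∈ Fintype.piFinset fun _ : Fin s => Finset.range (δ + 1)) :
    IntegrableOn (anchored δ f τ) (unitCube _) :=
  integrableOn_of_hardyKrauseVar_lt_top
    ((hardyKrauseVar_le_N hR hN hτ).trans_lt (ENNReal.mul_lt_top ENNReal.ofReal_lt_top hN))

theorem norm_walshCoeff_le {p : ℕ} [NeZero p] {F : Type*} [Field F] [Algebra (ZMod p) F]
    (pb : PowerBasis (ZMod p) F) {q : ℕ} [NeZero q] {φ : Fin q → F} (hφ : Function.Bijective φ)
    (h0 : φ 0 = 0) {s δ : ℕ} (hδ : 1 ≤ δ) {lam P Q R : ℝ} (hlam : 0 < lam) (hlam1 : lam ≤ 1)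
    (hP : 1 ≤ P) (hQ : 1 ≤ Q) (hR : 1 ≤ R) {γ : Finset (Fin s) → ℝ≥0} {f : (Fin s → ℝ) → ℝ}
    (hf : HasMixedDerivs δ f) (hN : N δ lam P Q R γ f < ∞) (k : Fin s → ℕ) :
    ‖walshCoeff pb φ f k‖ ≤
      ((δ + 1 : ℝ) ^ s * (8 * (q : ℝ) ^ (δ + 1)) ^ s * (1 + ∑ v, (γ v : ℝ))) *
        (N δ lam P Q R γ f).toReal * (q : ℝ) ^ (-mu q δ lam k) := by
  have hq : 0 < q := Nat.pos_of_ne_zero (NeZero.ne q)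
  have hq' : (0 : ℝ) < q := by exact_mod_cast hq
  set A := N δ lam P Q R γ f with hA
  set T := Fintype.piFinset fun _ : Fin s => Finset.range (δ + 1) with hT
  set G : ℝ := 1 + ∑ v, (γ v : ℝ) with hG
  have hG0 : 0 ≤ G := by
    have : 0 ≤ ∑ v, (γ v : ℝ) := Finset.sum_nonneg fun v _ => (γ v).2
    linarith
  set e : Fin s → ℕ → ℤ → ℂ := fun j => walFactor pb φ (k j) with he
  set L : Fin s → List ℕ := fun j => digitPositions q (k j) with hL
  have hfac : ∀ j, ∀ a ∈ L j, IsDigitFactor q (e j a) := fun j a ha =>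
    isDigitFactor_walFactor pb hφ h0 ha
  have hpos : ∀ j, ∀ a ∈ L j, 0 < a := fun j a ha => by
    obtain ⟨l, -, -, rfl⟩ := mem_digitPositions.1 ha
    omega
  have hint : ∀ τ ∈ T, IntegrableOn (anchored δ f τ) (unitCube _) := fun τ hτ =>
    integrableOn_anchored_of_N_lt_top hR hN hτ
  have hcoeff : walshCoeff pb φ f k =
      ∫ x in unitCube (Fin s), (f x : ℂ) * ∏ j, digitProd q (e j) (L j) (x j) := by
    unfold walshCoeff
    refine setIntegral_congr_fun (measurableSet_unitCube _) fun x hx => ?_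
    simp only [map_prod]
    congr 1
    exact Finset.prod_congr rfl fun j _ =>
      conj_wal_eq_digitProd pb h0 (k j) (mem_unitCube.1 hx j).1
  have hdecay : ∏ j, 8 * ((q : ℝ) ^ (δ + 1) * (q : ℝ) ^
      (-((((L j).take δ).sum : ℝ) + lam * ((L j).getD δ 0 : ℝ)))) =
      (8 * (q : ℝ) ^ (δ + 1)) ^ s * (q : ℝ) ^ (-mu q δ lam k) := by
    simp_rw [← mul_assoc]
    rw [Finset.prod_mul_distrib, Finset.prod_const, Finset.card_univ, Fintype.card_fin,
      ← Real.rpow_sum_of_pos hq', Finset.sum_neg_distrib]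
    rfl
  set D : ℝ := (8 * (q : ℝ) ^ (δ + 1)) ^ s * (q : ℝ) ^ (-mu q δ lam k) with hD
  have hD0 : 0 ≤ D := by positivity
  have hmain : ‖walshCoeff pb φ f k‖ₑ ≤
      ∑ _τ ∈ T, ENNReal.ofReal D * (ENNReal.ofReal G * A) := by
    rw [hcoeff, setIntegral_mul_prod_eq_sum hδ hf
      (fun τ hτ => integrable_mixedDeriv_of_anchored (hint τ hτ))
      (fun j => measurable_digitProd q (e j) (L j)) fun j x => norm_digitProd_le (hfac j) x]
    refine (enorm_sum_le _ _).trans (Finset.sum_le_sum fun τ hτ => ?_)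
    refine (enorm_integral_mixedDeriv_mul_prod_le hq hδ hlam hlam1 hP hQ
      (fun j => Nat.lt_succ_iff.1 (Finset.mem_range.1 (Fintype.mem_piFinset.1 hτ j))) (hint τ hτ)
      (fun j => digitPositions_pairwise q (k j)) hpos hfac).trans ?_
    rw [hdecay]
    exact mul_le_mul_right (hardyKrauseVar_le_N hR hN hτ) _
  have hcard : T.card = (δ + 1) ^ s := by
    rw [hT, Fintype.card_piFinset]
    simp
  rw [Finset.sum_const, hcard, nsmul_eq_mul, ← ofReal_norm] at hmain
  have hfin : ((((δ + 1) ^ s : ℕ) : ℝ≥0∞) * (ENNReal.ofReal D * (ENNReal.ofReal G * A))) ≠ ∞ :=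
    ENNReal.mul_ne_top (ENNReal.natCast_ne_top _) (ENNReal.mul_ne_top ENNReal.ofReal_ne_top
      (ENNReal.mul_ne_top ENNReal.ofReal_ne_top hN.ne))
  have hreal := (ENNReal.ofReal_le_iff_le_toReal hfin).1 hmain
  rw [ENNReal.toReal_mul, ENNReal.toReal_mul, ENNReal.toReal_mul, ENNReal.toReal_ofReal hD0,
    ENNReal.toReal_ofReal hG0, ENNReal.toReal_natCast] at hreal
  refine hreal.trans (le_of_eq ?_)
  push_cast
  ring

end WalshDecay

theorem mainTheorem1 (p r : ℕ) [Fact p.Prime] (s δ : ℕ) (hδ : 1 ≤ δ)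
    (γ : Finset (Fin s) → ℝ≥0) :
    ∃ C : ℝ, 0 < C ∧
      ∀ (F : Type*) [Field F] [Algebra (ZMod p) F] (pb : PowerBasis (ZMod p) F), pb.dim = r →
      ∀ φ : Fin (p ^ r) → F, Function.Bijective φ → φ 0 = 0 →
      ∀ lam P Q R : ℝ, 0 < lam → lam ≤ 1 → 1 ≤ P → 1 ≤ Q → 1 ≤ R →
      ∀ f : (Fin s → ℝ) → ℝ, WalshDecay.HasMixedDerivs δ f →
        WalshDecay.N δ lam P Q R γ f < ∞ →
        MemLp f 2 (volume.restrict (WalshDecay.unitCube (Fin s))) ∧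
        (∃ C' : ℝ, 0 < C' ∧ ∀ k : Fin s → ℕ, k ≠ 0 →
          ‖WalshDecay.walshCoeff pb φ f k‖ ≤
            C' * ((p ^ r : ℕ) : ℝ) ^ (-WalshDecay.mu (p ^ r) δ lam k)) ∧
        ∀ k : Fin s → ℕ,
          ‖WalshDecay.walshCoeff pb φ f k‖ ≤
            C * (WalshDecay.N δ lam P Q R γ f).toReal *
              ((p ^ r : ℕ) : ℝ) ^ (-WalshDecay.mu (p ^ r) δ lam k) := by
  have hp0 : 0 < p := (Fact.out : p.Prime).pos
  have hq0 : (0 : ℝ) < (p ^ r : ℕ) := by exact_mod_cast pow_pos hp0 r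
  have hγ : 0 ≤ ∑ v, (γ v : ℝ) := Finset.sum_nonneg fun v _ => (γ v).2
  have hC : 0 < (δ + 1 : ℝ) ^ s * (8 * ((p ^ r : ℕ) : ℝ) ^ (δ + 1)) ^ s *
      (1 + ∑ v, (γ v : ℝ)) := by positivity
  refine ⟨_, hC, ?_⟩
  intro F _ _ pb _ φ hφ h0 lam P Q R hlam hlam1 hP hQ hR f hf hN
  have hbound := WalshDecay.norm_walshCoeff_le pb hφ h0 hδ hlam hlam1 hP hQ hR hf hN
  refine ⟨WalshDecay.memLp_two_of_integrable_mixedDeriv hδ hf fun τ hτ =>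
    WalshDecay.integrable_mixedDeriv_of_anchored
      (WalshDecay.integrableOn_anchored_of_N_lt_top hR hN hτ), ?_, hbound⟩
  -- Adding `1` makes the constant positive also for `N(f) = 0`.
  refine ⟨_, add_pos_of_nonneg_of_pos (mul_nonneg hC.le
    (ENNReal.toReal_nonneg (a := WalshDecay.N δ lam P Q R γ f))) one_pos,
    fun k _ => (hbound k).trans ?_⟩
  exact mul_le_mul_of_nonneg_right (le_add_of_nonneg_right zero_le_one)
    (Real.rpow_nonneg hq0.le _)
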